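/- Let $\ell,s,n_1,\dots,n_\ell,k_1,\dots,k_\ell$ be non-negative integers, with $k_i\ge 1$ for at least one $i$ (in particular $\ell\ge1$), such that $n_i\ge 4\ell^2k_i^2s$ for every $i$. Let $V_1,\dots,V_\ell$ be pairwise disjoint sets with $|V_i|=n_i$, and let $\bigsqcup_{i=1}^\ell\binom{V_i}{k_i}$ denote the collection of all subsets $F$ of $V_1\cup\dots\cup V_\ell$ with $|F\cap V_i|=k_i$ for every $i$. For a family $\mathcal F$ of finite sets, let $\nu(\mathcal F)$ be the maximum number of pairwise disjoint members of $\mathcal F$. (The binomial coefficient $\binom{m}{0}$ is $1$ for every integer $m$.) (a) If $\mathcal F\subseteq\bigsqcup_{i=1}^\ell\binom{V_i}{k_i}$ satisfies $\nu(\mathcal F)\le s$, then $$|\mathcal F|\le\max_{1\le i\le\ell}\left[\binom{n_i}{k_i}-\binom{n_i-s}{k_i}\right]\prod_{j\ne i}\binom{n_j}{k_j}.$$ (b) This bound is best possible. For every $i$ and every $S_i\subseteq V_i$ with $|S_i|=s$, the family $\mathcal E_i=\{E\in\bigsqcup_{j=1}^\ell\binom{V_j}{k_j}: E\cap S_i\ne\emptyset\}$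 satisfies $\nu(\mathcal E_i)\le s$ and $|\mathcal E_i|=\left[\binom{n_i}{k_i}-\binom{n_i-s}{k_i}\right]\prod_{j\ne i}\binom{n_j}{k_j}$; and for some $i$ there is such a set $S_i$ for which $|\mathcal E_i|$ equals the maximum in (a). -/

import Mathlib

namespace DirectProduct

variable {α : Type*} [DecidableEq α]

/-- The direct product of the `binom(V i, k i)`: all subsets `F` of the union of the `V i`
with `|F ∩ V i| = k i` for every `i`. -/
def layer {l : ℕ} (V : Fin l → Finset α) (k : Fin l → ℕ) : Finset (Finset α) :=
  (Finset.univ.biUnion V).powerset.filter (fun F => ∀ i, (F ∩ V i).card = k i)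

/-- The matching number: the maximum number of pairwise disjoint members of the family. -/
def matchingNumber (F : Finset (Finset α)) : ℕ :=
  (F.powerset.filter (fun M => ∀ A ∈ M, ∀ B ∈ M, A ≠ B → Disjoint A B)).sup Finset.card

/-- The family of all members of the direct product that meet the set `S`. -/
def meeting {l : ℕ} (V : Fin l → Finset α) (k : Fin l → ℕ) (S : Finset α) :
    Finset (Finset α) :=
  (layer V k).filter (fun E => (E ∩ S).Nonempty)

/-- The number `[binom(n i, k i) - binom(n i - s, k i)] * ∏_{j ≠ i} binom(n j, k j)`. The inner
subtraction truncates only if `n i < s`; under the bound `n i ≥ 4 l² (k i)² s` this forces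
`k i = 0`, where both binomial coefficients are `1`. -/
def bound {l : ℕ} (n k : Fin l → ℕ) (s : ℕ) (i : Fin l) : ℕ :=
  ((n i).choose (k i) - (n i - s).choose (k i)) *
    ∏ j ∈ Finset.univ.erase i, (n j).choose (k j)

end DirectProduct

namespace DirectProduct

/-! ### Counting members of the layer through their traces on the blocks -/

section Counting

variable {α : Type*} [DecidableEq α] {l : ℕ} {V : Fin l → Finset α} {k : Fin l → ℕ}

/-! Let `P` be the size of the layer, `d j = k j / |V j|` the proportion of its members through a
given vertex of `V j`, and `p = max d j`. The upper bound is proved by induction on `s`, for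
families that are shifted inside each block (`exists_shifted`).

Suppose first that some `v ∈ V i` has degree above `P * d i / (4 l)`. By the size hypothesis, fewer
edges than that pass through `v` and meet `s` given edges avoiding `v`. So a matching of size `s`
avoiding `v` would extend (`exists_disjoint_edge`), and the edges avoiding `v` have matching number
at most `s - 1`. Induction bounds their number; the edges through `v` number at most `P * d i`, and
`add_bound_update_le` shows that the sum stays below the maximum.

Otherwise all degrees are small (`card_le_of_degree_le`). Call a vertex of `V j` heavy if its degree
exceeds `P * d j * (7/3 * s * l * p)`. Given `s + 1` heavy vertices, forming a set `T`, each lies in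
an edge that meets `T` nowhere else and is sparse outside `T` (`exists_sparse_edge`, resting on the
ballot-type count `card_powersetCard_not_sparse`). Shiftedness then pushes these edges into distinct
residue classes of ranks, which gives `s + 1` disjoint edges (`hasMatching_of_transversal`). Hence
at most `s` vertices are heavy. The vertices of a maximal matching cover the family; its light
vertices account for at most `7/12 * P * s * p` edges and its heavy ones for at most `1/4 * P * s *
p`. The total `5/6 * P * s * p` is less than the lower bound `7/8 * P * s * p` for the extremal
family on a block with `d i = p`. -/

theorem mem_layer {E : Finset α} :
    E ∈ layer V k ↔ (∀ x ∈ E, ∃ i, x ∈ V i) ∧ ∀ i, (E ∩ V i).card = k i := by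
  simp [layer, Finset.subset_iff]

theorem biUnion_inter_eq {E : Finset α} (hE : ∀ x ∈ E, ∃ i, x ∈ V i) :
    Finset.univ.biUnion (fun j => E ∩ V j) = E := by
  ext x
  simp only [Finset.mem_biUnion, Finset.mem_univ, true_and, Finset.mem_inter, exists_and_left]
  exact ⟨fun h => h.1, fun h => ⟨h, hE x h⟩⟩

theorem biUnion_inter_part (hV : ∀ i j, i ≠ j → Disjoint (V i) (V j)) {g : Fin l → Finset α}
    (hg : ∀ j, g j ⊆ V j) (i : Fin l) : Finset.univ.biUnion g ∩ V i = g i := by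
  ext x
  simp only [Finset.mem_inter, Finset.mem_biUnion, Finset.mem_univ, true_and]
  constructor
  · rintro ⟨⟨j, hj⟩, hi⟩
    by_cases h : j = i
    · exact h ▸ hj
    · exact absurd hi (Finset.disjoint_left.1 (hV j i h) (hg j hj))
  · exact fun h => ⟨⟨i, h⟩, hg i h⟩

/-- A set of members of the layer whose traces lie in prescribed families. -/
theorem card_le_prod {𝒜 : Finset (Finset α)} (h𝒜 : 𝒜 ⊆ layer V k)
    {B : Fin l → Finset (Finset α)} (hB : ∀ E ∈ 𝒜, ∀ j, E ∩ V j ∈ B j) :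
    𝒜.card ≤ ∏ j, (B j).card := by
  rw [← Fintype.card_piFinset]
  refine Finset.card_le_card_of_injOn (fun E j => E ∩ V j) (fun E hE => ?_) ?_
  · simpa using hB E hE
  · intro E hE E' hE' h
    rw [← biUnion_inter_eq (mem_layer.1 (h𝒜 hE)).1, ← biUnion_inter_eq (mem_layer.1 (h𝒜 hE')).1]
    exact congrArg (fun g => Finset.univ.biUnion g) h

/-- Disjoint blocks make the traces independent: any choice of admissible traces glues to one
member. This is the equality case of `card_le_prod`. -/
theorem card_filter_layer (hV : ∀ i j, i ≠ j → Disjoint (V i) (V j))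
    {B : Fin l → Finset (Finset α)} (hB : ∀ j, B j ⊆ (V j).powersetCard (k j)) :
    ((layer V k).filter (fun E => ∀ j, E ∩ V j ∈ B j)).card = ∏ j, (B j).card := by
  refine le_antisymm (card_le_prod (Finset.filter_subset _ _)
    fun E hE => (Finset.mem_filter.1 hE).2) ?_
  rw [← Fintype.card_piFinset]
  have sub : ∀ g ∈ Fintype.piFinset B, ∀ j, g j ⊆ V j := fun g hg j =>
    (Finset.mem_powersetCard.1 (hB j (Fintype.mem_piFinset.1 hg j))).1
  refine Finset.card_le_card_of_injOn (fun g => Finset.univ.biUnion g) (fun g hg => ?_) ?_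
  · have hg' := Fintype.mem_piFinset.1 hg
    simp only [Finset.coe_filter, Set.mem_ofPred_eq, mem_layer, biUnion_inter_part hV (sub g hg)]
    refine ⟨⟨fun x hx => ?_, fun i => (Finset.mem_powersetCard.1 (hB i (hg' i))).2⟩, hg'⟩
    obtain ⟨j, -, hj⟩ := Finset.mem_biUnion.1 hx
    exact ⟨j, sub g hg j hj⟩
  · intro g hg g' hg' h
    funext i
    rw [← biUnion_inter_part hV (sub g hg) i, ← biUnion_inter_part hV (sub g' hg') i]
    exact congrArg (fun E => E ∩ V i) h

theorem inter_mem_powersetCard {E : Finset α} (hE : E ∈ layer V k) (j : Fin l) :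
    E ∩ V j ∈ (V j).powersetCard (k j) :=
  Finset.mem_powersetCard.2 ⟨Finset.inter_subset_right, (mem_layer.1 hE).2 j⟩

theorem card_layer (hV : ∀ i j, i ≠ j → Disjoint (V i) (V j)) :
    (layer V k).card = ∏ j, (V j).card.choose (k j) := by
  rw [← Finset.filter_true_of_mem fun E (hE : E ∈ layer V k) => inter_mem_powersetCard hE,
    card_filter_layer hV fun j => subset_rfl]
  simp

theorem card_layer_disjoint (hV : ∀ i j, i ≠ j → Disjoint (V i) (V j)) (i : Fin l) {S : Finset α}
    (hS : S ⊆ V i) :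
    ((layer V k).filter (fun E => ¬ (E ∩ S).Nonempty)).card =
      ((V i).card - S.card).choose (k i) *
        ∏ j ∈ Finset.univ.erase i, (V j).card.choose (k j) := by
  have key := card_filter_layer (k := k) hV
    (B := fun j => if j = i then (V i \ S).powersetCard (k i) else (V j).powersetCard (k j))
    (fun j => by
      by_cases h : j = i
      · subst h
        simp only [if_true]
        exact Finset.powersetCard_mono Finset.sdiff_subset
      · simp [h])
  rw [← Finset.mul_prod_erase _ _ (Finset.mem_univ i)] at key
  rw [Finset.prod_congr rfl (g := fun j => (V j).card.choose (k j)) (fun j hj => by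
    simp [Finset.ne_of_mem_erase hj])] at key
  simp only [if_true, Finset.card_powersetCard, Finset.card_sdiff_of_subset hS] at key
  rw [← key]
  congr 1
  refine Finset.filter_congr fun E hE => ?_
  rw [Finset.not_nonempty_iff_eq_empty, ← Finset.disjoint_iff_inter_eq_empty]
  constructor
  · intro h j
    by_cases hj : j = i
    · subst hj
      simp only [if_true, Finset.mem_powersetCard]
      refine ⟨fun x hx => ?_, (mem_layer.1 hE).2 j⟩
      rw [Finset.mem_inter] at hx
      exact Finset.mem_sdiff.2 ⟨hx.2, Finset.disjoint_left.1 h hx.1⟩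
    · simpa [hj] using (mem_layer.1 hE).2 j
  · intro h
    have hi := h i
    simp only [if_true, Finset.mem_powersetCard] at hi
    refine Finset.disjoint_left.2 fun x hx hxS => ?_
    exact (Finset.mem_sdiff.1 (hi.1 (Finset.mem_inter.2 ⟨hx, hS hxS⟩))).2 hxS

theorem card_meeting (hV : ∀ i j, i ≠ j → Disjoint (V i) (V j)) (i : Fin l) {S : Finset α}
    (hS : S ⊆ V i) :
    (meeting V k S).card = bound (fun j => (V j).card) k S.card i := by
  have h := Finset.card_filter_add_card_filter_not (s := layer V k)
    (fun E => (E ∩ S).Nonempty)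
  rw [card_layer_disjoint hV i hS, card_layer hV,
    ← Finset.mul_prod_erase _ _ (Finset.mem_univ i)] at h
  rw [bound, Nat.sub_mul]
  exact Nat.eq_sub_of_add_eq h

theorem matchingNumber_meeting_le (S : Finset α) :
    matchingNumber (meeting V k S) ≤ S.card := by
  refine Finset.sup_le fun M hM => ?_
  rw [Finset.mem_filter, Finset.mem_powerset] at hM
  have hne : ∀ E ∈ M, ∃ x, x ∈ E ∧ x ∈ S := fun E hE => by
    obtain ⟨x, hx⟩ := (Finset.mem_filter.1 (hM.1 hE)).2
    exact ⟨x, Finset.mem_inter.1 hx⟩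
  choose g hg using hne
  refine Finset.card_le_card_of_injOn (s := M.attach) (t := S) (fun E => g E.1 E.2)
    (fun E _ => (hg E.1 E.2).2) (fun A _ B _ h => ?_) |> Finset.card_attach.symm.trans_le
  by_contra hAB
  refine Finset.disjoint_left.1 (hM.2 A A.2 B B.2 fun h => hAB (Subtype.ext h)) (hg A.1 A.2).1 ?_
  have h' : g A.1 A.2 = g B.1 B.2 := h
  exact h' ▸ (hg B.1 B.2).1

/-- `card_le_prod` in terms of densities, with at most two nontrivial factors. -/
theorem card_le_density {𝒜 : Finset (Finset α)} (h𝒜 : 𝒜 ⊆ layer V k)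
    {B : Fin l → Finset (Finset α)} (hB : ∀ E ∈ 𝒜, ∀ j, E ∩ V j ∈ B j)
    (i i' : Fin l) (a b : ℝ)
    (hc : ∀ j, ((B j).card : ℝ) ≤ ((V j).card.choose (k j) : ℝ) *
      ((if j = i then a else 1) * (if j = i' then b else 1))) :
    (𝒜.card : ℝ) ≤ (∏ j, ((V j).card.choose (k j) : ℝ)) * (a * b) := by
  calc (𝒜.card : ℝ) ≤ ((∏ j, (B j).card : ℕ) : ℝ) := by exact_mod_cast card_le_prod h𝒜 hB
    _ = ∏ j, ((B j).card : ℝ) := by push_cast; rfl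
    _ ≤ ∏ j, ((V j).card.choose (k j) : ℝ) *
          ((if j = i then a else 1) * (if j = i' then b else 1)) :=
        Finset.prod_le_prod (fun j _ => Nat.cast_nonneg _) fun j _ => hc j
    _ = _ := by
      rw [Finset.prod_mul_distrib, Finset.prod_mul_distrib]
      simp

theorem card_powersetCard_filter_mem {W : Finset α} {v : α} (hv : v ∈ W) (m : ℕ) :
    (((W.powersetCard m).filter (fun A => v ∈ A)).card : ℝ) =
      (W.card.choose m : ℝ) * (m / W.card) := by
  have hW : (W.card : ℝ) ≠ 0 := by
    exact_mod_cast (Finset.card_pos.2 ⟨v, hv⟩).ne'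
  have h1 : ((W.powersetCard m).filter (fun A => ¬ v ∈ A)) = (W.erase v).powersetCard m := by
    ext A
    simp only [Finset.mem_filter, Finset.mem_powersetCard, Finset.subset_erase]
    tauto
  have h2 := Finset.card_filter_add_card_filter_not (s := W.powersetCard m) (fun A => v ∈ A)
  rw [h1, Finset.card_powersetCard, Finset.card_powersetCard, Finset.card_erase_of_mem hv] at h2
  obtain ⟨n, hn⟩ : ∃ n, W.card = n + 1 := ⟨W.card - 1, by
    have := Finset.card_pos.2 ⟨v, hv⟩; omega⟩
  rw [hn] at h2 hW ⊢
  simp only [Nat.add_sub_cancel] at h2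
  cases m with
  | zero => simp
  | succ m =>
    rw [Nat.choose_succ_succ'] at h2
    have h3 : ((W.powersetCard (m + 1)).filter (fun A => v ∈ A)).card = n.choose m := by omega
    rw [h3]
    have h4 : ((n + 1 : ℕ) : ℝ) * n.choose m = (n + 1).choose (m + 1) * ((m + 1 : ℕ) : ℝ) := by
      exact_mod_cast Nat.add_one_mul_choose_eq n m
    field_simp
    linarith

/-- Negative correlation: the exact proportion is `m (m - 1) / (n (n - 1))`, and `(m - 1) / (n - 1)
≤ m / n` because `m ≤ n`. Two vertices of one block can thus be treated like vertices of different
blocks. -/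
theorem card_powersetCard_filter_mem_mem {W : Finset α} {u v : α} (hv : v ∈ W) (hu : u ∈ W)
    (huv : u ≠ v) {m : ℕ} (hm : m ≤ W.card) :
    (((W.powersetCard m).filter (fun A => v ∈ A ∧ u ∈ A)).card : ℝ) ≤
      (W.card.choose m : ℝ) * ((m / W.card) * (m / W.card)) := by
  cases m with
  | zero =>
    have : ((W.powersetCard 0).filter (fun A => v ∈ A ∧ u ∈ A)) = ∅ := by
      simp
    rw [this]; simp
  | succ m =>
    have hu' : u ∈ W.erase v := Finset.mem_erase.2 ⟨huv, hu⟩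
    have h1 : ((W.powersetCard (m + 1)).filter (fun A => v ∈ A ∧ u ∈ A)).card ≤
        (((W.erase v).powersetCard m).filter (fun A => u ∈ A)).card := by
      refine Finset.card_le_card_of_injOn (fun A => A.erase v) (fun A hA => ?_) ?_
      · simp only [Finset.coe_filter, Set.mem_ofPred_eq, Finset.mem_powersetCard] at hA ⊢
        refine ⟨⟨Finset.erase_subset_erase _ hA.1.1, ?_⟩, Finset.mem_erase.2 ⟨huv, hA.2.2⟩⟩
        rw [Finset.card_erase_of_mem hA.2.1, hA.1.2]; rfl
      · intro A hA A' hA' h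
        simp only [Finset.coe_filter, Set.mem_ofPred_eq] at hA hA'
        rw [← Finset.insert_erase hA.2.1, ← Finset.insert_erase hA'.2.1]
        exact congrArg (insert v) h
    have h2 := card_powersetCard_filter_mem hu' m
    rw [Finset.card_erase_of_mem hv] at h2
    obtain ⟨n, hn⟩ : ∃ n, W.card = n + 1 := ⟨W.card - 1, by omega⟩
    rw [hn, Nat.add_sub_cancel] at h2
    have hn0 : 0 < n := by
      have := Finset.card_pos.2 ⟨u, hu'⟩
      rw [Finset.card_erase_of_mem hv] at this; omega
    have hnR : (0 : ℝ) < n := by exact_mod_cast hn0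
    have h4 : ((n + 1 : ℕ) : ℝ) * n.choose m = (n + 1).choose (m + 1) * ((m + 1 : ℕ) : ℝ) := by
      exact_mod_cast Nat.add_one_mul_choose_eq n m
    have h5 : (m : ℝ) / n ≤ ((m + 1 : ℕ) : ℝ) / ((n + 1 : ℕ) : ℝ) := by
      have : (m : ℝ) ≤ n := by exact_mod_cast (show m ≤ n by omega)
      push_cast
      rw [div_le_div_iff₀ hnR (by positivity)]
      nlinarith
    have h6 : (n.choose m : ℝ) = (n + 1).choose (m + 1) * (((m + 1 : ℕ) : ℝ) / ((n + 1 : ℕ) : ℝ)) := by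
      field_simp
      linarith
    rw [hn]
    calc _ ≤ ((((W.erase v).powersetCard m).filter (fun A => u ∈ A)).card : ℝ) := by
          exact_mod_cast h1
      _ = n.choose m * (m / n) := h2
      _ ≤ n.choose m * (((m + 1 : ℕ) : ℝ) / ((n + 1 : ℕ) : ℝ)) := by gcongr
      _ = _ := by rw [h6]; ring

end Counting

/-! ### Shifting inside the blocks -/

section Shifting

variable {α : Type*}

/-- The family contains `r` pairwise disjoint members (indexed, so that only nonempty members
are automatically distinct). -/
def HasMatching (F : Finset (Finset α)) (r : ℕ) : Prop :=
  ∃ f : Fin r → Finset α, (∀ a, f a ∈ F) ∧ ∀ a b, a ≠ b → Disjoint (f a) (f b)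

theorem HasMatching.cons {F F' : Finset (Finset α)} {r : ℕ} {f : Fin r → Finset α}
    (hf : ∀ a, f a ∈ F') (hd : ∀ a b, a ≠ b → Disjoint (f a) (f b)) (hF : F' ⊆ F)
    {E : Finset α} (hE : E ∈ F) (hEd : ∀ a, Disjoint E (f a)) : HasMatching F (r + 1) := by
  refine ⟨Fin.cons E f, fun a => ?_, fun a b => ?_⟩
  · refine Fin.cases ?_ (fun a => ?_) a
    · simpa using hE
    · simpa using hF (hf a)
  · refine Fin.cases ?_ (fun a => ?_) a <;> refine Fin.cases ?_ (fun b => ?_) b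
    · simp
    · intro _; simpa using hEd b
    · intro _; simpa using (hEd a).symm
    · intro h; simpa using hd a b fun h' => h (h' ▸ rfl)

variable [LinearOrder α]

/-- Closure under replacing an element of a block `W j` by a smaller one of the same block. -/
def Shifted {l : ℕ} (W : Fin l → Finset α) (F : Finset (Finset α)) : Prop :=
  ∀ j, ∀ x ∈ W j, ∀ y ∈ W j, x < y → ∀ E ∈ F, y ∈ E → x ∉ E → insert x (E.erase y) ∈ F

theorem HasMatching.le_matchingNumber {F : Finset (Finset α)} {r : ℕ} (h : HasMatching F r)
    (h0 : ∅ ∉ F) : r ≤ matchingNumber F := by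
  obtain ⟨f, hf, hd⟩ := h
  have inj : Function.Injective f := fun a b hab => by
    by_contra hne
    have := hd a b hne
    rw [hab, disjoint_self, Finset.bot_eq_empty] at this
    exact h0 (this ▸ hf b)
  have : (Finset.univ.image f).card = r := by
    rw [Finset.card_image_of_injective _ inj]; simp
  rw [← this]
  refine Finset.le_sup (f := Finset.card) ?_
  simp only [Finset.mem_filter, Finset.mem_powerset, Finset.subset_iff, Finset.mem_image,
    Finset.mem_univ, true_and]
  refine ⟨?_, ?_⟩
  · rintro _ ⟨a, rfl⟩; exact hf a
  · rintro _ ⟨a, rfl⟩ _ ⟨b, rfl⟩ hab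
    exact hd a b fun h => hab (h ▸ rfl)

/-- The image of `E` under the `(x, y)`-shift of the family `F`. -/
def shiftMap (F : Finset (Finset α)) (x y : α) (E : Finset α) : Finset α :=
  if y ∈ E ∧ x ∉ E ∧ insert x (E.erase y) ∉ F then insert x (E.erase y) else E

theorem insert_erase_insert_erase {x y : α} {E : Finset α} (hy : y ∈ E) (hx : x ∉ E) :
    insert y ((insert x (E.erase y)).erase x) = E := by
  rw [Finset.erase_insert (by simp [hx]), Finset.insert_erase hy]

theorem shiftMap_injOn (F : Finset (Finset α)) (x y : α) :
    Set.InjOn (shiftMap F x y) (F : Set (Finset α)) := by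
  intro E hE E' hE' h
  unfold shiftMap at h
  split_ifs at h with h1 h2 h2
  · rw [← insert_erase_insert_erase h1.1 h1.2.1, h, insert_erase_insert_erase h2.1 h2.2.1]
  · exact absurd (h ▸ hE') h1.2.2
  · exact absurd (h ▸ hE) h2.2.2
  · exact h

theorem mem_image_swap {x y a : α} {E : Finset α} :
    a ∈ E.image (Equiv.swap x y) ↔ Equiv.swap x y a ∈ E := by
  constructor
  · intro h
    obtain ⟨b, hb, rfl⟩ := Finset.mem_image.1 h
    simpa using hb
  · intro h
    exact Finset.mem_image.2 ⟨_, h, by simp⟩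

theorem image_swap_of_mem {x y : α} (hxy : x ≠ y) {E : Finset α} (hy : y ∈ E) (hx : x ∉ E) :
    E.image (Equiv.swap x y) = insert x (E.erase y) := by
  ext a
  rw [mem_image_swap]
  by_cases h1 : a = x
  · subst h1; simp [hy]
  by_cases h2 : a = y
  · subst h2; simp [hx, h1]
  · simp [Equiv.swap_apply_of_ne_of_ne h1 h2, h1, h2]

theorem image_swap_of_notMem {x y : α} {E : Finset α} (hy : y ∉ E) (hx : x ∉ E) :
    E.image (Equiv.swap x y) = E := by
  ext a
  rw [mem_image_swap]
  by_cases h1 : a = x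
  · subst h1; simp [hx, hy]
  by_cases h2 : a = y
  · subst h2; simp [hx, hy]
  · simp [Equiv.swap_apply_of_ne_of_ne h1 h2]

/-- If the matching uses a set that is new in the shifted family, applying the transposition of `x`
and `y` to every member gives a matching in `F`. The new set contains `x`, so no other member does.
-/
theorem HasMatching.of_shift {F : Finset (Finset α)} {x y : α} (hxy : x ≠ y) {r : ℕ}
    (h : HasMatching (F.image (shiftMap F x y)) r) : HasMatching F r := by
  obtain ⟨f, hf, hd⟩ := h
  by_cases hall : ∀ a, f a ∈ F
  · exact ⟨f, hall, hd⟩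
  push Not at hall
  obtain ⟨a₀, ha₀⟩ := hall
  have new : ∀ a, f a ∉ F → ∃ E ∈ F, y ∈ E ∧ x ∉ E ∧ insert x (E.erase y) = f a := by
    intro a ha
    obtain ⟨E, hE, hEa⟩ := Finset.mem_image.1 (hf a)
    unfold shiftMap at hEa
    split_ifs at hEa with h1
    · exact ⟨E, hE, h1.1, h1.2.1, hEa⟩
    · exact absurd (hEa ▸ hE) ha
  have invol : ∀ E : Finset α, (E.image (Equiv.swap x y)).image (Equiv.swap x y) = E := by
    intro E; ext a; simp
  obtain ⟨E₀, hE₀, hyE₀, hxE₀, hfE₀⟩ := new a₀ ha₀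
  refine ⟨fun a => (f a).image (Equiv.swap x y), fun a => ?_, fun a b hab =>
    (Finset.disjoint_image (Equiv.injective _)).2 (hd a b hab)⟩
  dsimp only
  by_cases haa : a = a₀
  · subst haa
    rw [← hfE₀, ← image_swap_of_mem hxy hyE₀ hxE₀, invol]
    exact hE₀
  have hxa : x ∉ f a := Finset.disjoint_right.1 (hd a a₀ haa) (by rw [← hfE₀]; simp)
  have haF : f a ∈ F := by
    by_contra hn
    obtain ⟨E, -, -, -, hE⟩ := new a hn
    exact hxa (by rw [← hE]; simp)
  -- A member containing `y` but not `x` can survive the shift only because its swapped copy already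
  -- lies in `F`.
  by_cases hya : y ∈ f a
  · rw [image_swap_of_mem hxy hya hxa]
    by_contra hn
    obtain ⟨E, hE, hEa⟩ := Finset.mem_image.1 (hf a)
    unfold shiftMap at hEa
    split_ifs at hEa with h1
    · exact hxa (by rw [← hEa]; simp)
    · subst hEa
      exact h1 ⟨hya, hxa, hn⟩
  · rwa [image_swap_of_notMem hya hxa]

variable {l : ℕ} {V : Fin l → Finset α} {k : Fin l → ℕ}

theorem insert_erase_mem_layer (hV : ∀ i j, i ≠ j → Disjoint (V i) (V j)) {E : Finset α}
    (hE : E ∈ layer V k) {i : Fin l} {x y : α} (hx : x ∈ V i) (hy : y ∈ V i) (hyE : y ∈ E)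
    (hxE : x ∉ E) : insert x (E.erase y) ∈ layer V k := by
  simp only [layer, Finset.mem_filter, Finset.mem_powerset] at hE ⊢
  refine ⟨Finset.insert_subset (Finset.mem_biUnion.2 ⟨i, Finset.mem_univ i, hx⟩)
    ((Finset.erase_subset _ _).trans hE.1), fun j => ?_⟩
  by_cases h : j = i
  · subst h
    rw [Finset.insert_inter_of_mem hx, Finset.erase_inter, Finset.card_insert_of_notMem
      (by simp [hxE]), Finset.card_erase_of_mem (by simp [hyE, hy]), ← hE.2 j]
    have : 0 < (E ∩ V j).card := Finset.card_pos.2 ⟨y, by simp [hyE, hy]⟩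
    omega
  · rw [Finset.insert_inter_of_notMem (Finset.disjoint_right.1 (hV j i h) hx),
      Finset.erase_inter, Finset.erase_eq_of_notMem, hE.2 j]
    simp [Finset.disjoint_right.1 (hV j i h) hy]

/-- Among the families of the same size without `r` disjoint members, take one with least total rank
of elements. A shift that moved anything would lower this total. -/
theorem exists_shifted (hV : ∀ i j, i ≠ j → Disjoint (V i) (V j)) {F : Finset (Finset α)}
    (hF : F ⊆ layer V k) {r : ℕ} (hr : ¬ HasMatching F r) :
    ∃ F' : Finset (Finset α), F' ⊆ layer V k ∧ F'.card = F.card ∧ ¬ HasMatching F' r ∧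
      Shifted V F' := by
  classical
  let U : Finset α := Finset.univ.biUnion V
  let rk : α → ℕ := fun x => (U.filter (· < x)).card
  let wt : Finset α → ℕ := fun E => ∑ x ∈ E, rk x
  let C := (layer V k).powerset.filter fun G => G.card = F.card ∧ ¬ HasMatching G r
  obtain ⟨G, hG, hmin⟩ := C.exists_min_image (fun G => ∑ E ∈ G, wt E)
    ⟨F, by simp [C, hF, hr]⟩
  simp only [C, Finset.mem_filter, Finset.mem_powerset] at hG hmin
  refine ⟨G, hG.1, hG.2.1, hG.2.2, fun i x hx y hy hxy E hE hyE hxE => ?_⟩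
  by_contra hn
  have hrk : rk x < rk y := by
    refine Finset.card_lt_card ⟨fun z hz => ?_, fun hsub => ?_⟩
    · rw [Finset.mem_filter] at hz ⊢
      exact ⟨hz.1, hz.2.trans hxy⟩
    · have : x ∈ U.filter (· < x) := hsub (Finset.mem_filter.2
        ⟨Finset.mem_biUnion.2 ⟨i, Finset.mem_univ i, hx⟩, hxy⟩)
      simp at this
  have hwt : ∀ A : Finset α, y ∈ A → x ∉ A → wt (insert x (A.erase y)) < wt A := by
    intro A hyA hxA
    simp only [wt]
    rw [Finset.sum_insert (by simp [hxA]), ← Finset.add_sum_erase A rk hyA]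
    omega
  have h := hmin (G.image (shiftMap G x y)) ⟨?_, ?_, ?_⟩
  · rw [Finset.sum_image (shiftMap_injOn G x y)] at h
    refine absurd h (not_le.2 (Finset.sum_lt_sum (fun A _ => ?_) ⟨E, hE, ?_⟩))
    · unfold shiftMap
      split_ifs with h1
      · exact (hwt A h1.1 h1.2.1).le
      · exact le_rfl
    · rw [shiftMap, if_pos ⟨hyE, hxE, hn⟩]
      exact hwt E hyE hxE
  · intro A hA
    obtain ⟨B, hB, rfl⟩ := Finset.mem_image.1 hA
    unfold shiftMap
    split_ifs with h1
    · exact insert_erase_mem_layer hV (hG.1 hB) hx hy h1.1 h1.2.1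
    · exact hG.1 hB
  · rw [Finset.card_image_of_injOn (shiftMap_injOn G x y), hG.2.1]
  · exact fun h => hG.2.2 (h.of_shift hxy.ne)

/-- A shifted family is closed under passing to sets that are componentwise smaller. -/
theorem Shifted.mem_of_dominated {W : Fin l → Finset α} {F : Finset (Finset α)}
    (hF : Shifted W F) (hW : ∀ i j, i ≠ j → Disjoint (W i) (W j)) (A : Finset α) :
    ∀ (N : ℕ) (E : Finset α), (E \ A).card ≤ N → E ∈ F →
      (∀ a, (∀ j, a ∉ W j) → (a ∈ A ↔ a ∈ E)) →
      (∀ j, (E ∩ W j).card = (A ∩ W j).card) →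
      (∀ j z, ((E ∩ W j).filter (· ≤ z)).card ≤ ((A ∩ W j).filter (· ≤ z)).card) → A ∈ F := by
  intro N
  induction N with
  | zero =>
    intro E hN hE hout hcard _
    have hEA : E ⊆ A := Finset.sdiff_eq_empty_iff_subset.1 (Finset.card_eq_zero.1 (by omega))
    have : A = E := by
      refine Finset.Subset.antisymm (fun a ha => ?_) hEA
      by_cases h : ∀ j, a ∉ W j
      · exact (hout a h).1 ha
      · push Not at h
        obtain ⟨j, hj⟩ := h
        have := Finset.eq_of_subset_of_card_le (Finset.inter_subset_inter_right (u := W j) hEA)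
          (hcard j).ge
        exact (Finset.mem_inter.1 (this.symm ▸ Finset.mem_inter.2 ⟨ha, hj⟩ : a ∈ E ∩ W j)).1
    exact this ▸ hE
  | succ N ih =>
    intro E hN hE hout hcard hdom
    by_cases hEA : (E \ A).card ≤ N
    · exact ih E hEA hE hout hcard hdom
    obtain ⟨y₀, hy₀⟩ : (E \ A).Nonempty := Finset.card_pos.1 (by omega)
    rw [Finset.mem_sdiff] at hy₀
    have : ∃ j, y₀ ∈ W j := by
      by_contra h
      push Not at h
      exact hy₀.2 ((hout y₀ h).2 hy₀.1)
    obtain ⟨j, hj⟩ := this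
    have hne : ((E ∩ W j) \ A).Nonempty := ⟨y₀, by simp [hy₀, hj]⟩
    -- The smallest `y` is chosen so that domination survives its replacement by `x`: below `y` the
    -- new trace lies inside `A`, and from `y` on the counts do not change.
    obtain ⟨y, hy, hymin⟩ : ∃ y ∈ (E ∩ W j) \ A, ∀ z ∈ (E ∩ W j) \ A, y ≤ z :=
      ⟨_, Finset.min'_mem _ hne, fun z hz => Finset.min'_le _ _ hz⟩
    simp only [Finset.mem_sdiff, Finset.mem_inter] at hy hymin
    -- Without such an `x`, the part of `A` up to `y` would be strictly contained in that of `E`,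
    -- against domination at `y`.
    obtain ⟨x, hxA, hxW, hxE, hxy⟩ : ∃ x ∈ A, x ∈ W j ∧ x ∉ E ∧ x < y := by
      by_contra hcon
      push Not at hcon
      have hlt : ((A ∩ W j).filter (· ≤ y)).card < ((E ∩ W j).filter (· ≤ y)).card := by
        refine Finset.card_lt_card ⟨fun z hz => ?_, fun hsub => ?_⟩
        · simp only [Finset.mem_filter, Finset.mem_inter] at hz ⊢
          refine ⟨⟨?_, hz.1.2⟩, hz.2⟩
          by_contra hzE
          exact hy.2 (le_antisymm hz.2 (hcon z hz.1.1 hz.1.2 hzE) ▸ hz.1.1)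
        · have := hsub (show y ∈ _ by simp [hy])
          simp [hy.2] at this
      exact absurd (hdom j y) (not_le.2 hlt)
    have hE' := hF j x hxW y hy.1.2 hxy E hE hy.1.1 hxE
    have other : ∀ j', j' ≠ j → insert x (E.erase y) ∩ W j' = E ∩ W j' := fun j' h => by
      rw [Finset.insert_inter_of_notMem (Finset.disjoint_right.1 (hW j' j h) hxW),
        Finset.erase_inter, Finset.erase_eq_of_notMem]
      simp [Finset.disjoint_right.1 (hW j' j h) hy.1.2]
    have same : insert x (E.erase y) ∩ W j = insert x ((E ∩ W j).erase y) := by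
      rw [Finset.insert_inter_of_mem hxW, Finset.erase_inter]
    refine ih _ ?_ hE' ?_ ?_ ?_
    · have : insert x (E.erase y) \ A = (E \ A).erase y := by
        ext z
        simp only [Finset.mem_sdiff, Finset.mem_insert, Finset.mem_erase]
        constructor
        · rintro ⟨rfl | h, h2⟩
          · exact absurd hxA h2
          · exact ⟨h.1, h.2, h2⟩
        · rintro ⟨h1, h2, h3⟩
          exact ⟨Or.inr ⟨h1, h2⟩, h3⟩
      rw [this, Finset.card_erase_of_mem (by simp [hy])]
      omega
    · intro a ha
      have h1 : a ≠ x := fun h => ha j (h ▸ hxW)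
      have h2 : a ≠ y := fun h => ha j (h ▸ hy.1.2)
      simp [hout a ha, h1, h2]
    · intro j'
      by_cases h : j' = j
      · subst h
        rw [same, Finset.card_insert_of_notMem (by simp [hxE]),
          Finset.card_erase_of_mem (by simp [hy]), ← hcard j']
        have : 0 < (E ∩ W j').card := Finset.card_pos.2 ⟨y, by simp [hy]⟩
        omega
      · rw [other j' h, hcard j']
    · intro j' z
      by_cases h : j' = j
      · subst h
        rw [same]
        by_cases hzy : y ≤ z
        · refine le_trans ?_ (hdom j' z)
          rw [Finset.filter_insert, if_pos (hxy.le.trans hzy), Finset.filter_erase,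
            Finset.card_insert_of_notMem (by simp [hxE]),
            Finset.card_erase_of_mem (by simp [hy, hzy])]
          have : 0 < ((E ∩ W j').filter (· ≤ z)).card :=
            Finset.card_pos.2 ⟨y, by simp [hy, hzy]⟩
          omega
        · refine Finset.card_le_card fun a ha => ?_
          simp only [Finset.mem_filter, Finset.mem_insert, Finset.mem_erase,
            Finset.mem_inter] at ha ⊢
          obtain ⟨rfl | ⟨-, haE, haW⟩, haz⟩ := ha
          · exact ⟨⟨hxA, hxW⟩, haz⟩
          · refine ⟨⟨?_, haW⟩, haz⟩
            by_contra haA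
            exact hzy ((hymin a ⟨⟨haE, haW⟩, haA⟩).trans haz)
      · rw [other j' h]
        exact hdom j' z

end Shifting

/-! ### Sparse sets, and disjoint edges from residue classes of ranks -/

section Sparse

variable {α : Type*} [LinearOrder α]

/-- The `a`-th smallest element of `A` has rank at least `q * a` in `W`, for every `a ≥ 1`. -/
@[reducible] def Sparse (q : ℕ) (W A : Finset α) : Prop :=
  ∀ x ∈ A, q * (A.filter (· ≤ x)).card ≤ (W.filter (· ≤ x)).card

/-- A ballot-type estimate, by induction on the largest element `m`. Once the ground set has at
least `(s + 1) * (k + 1)` elements, `m` in last position creates no violation, so the count obeys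
Pascal's recursion, as does the right-hand side. -/
theorem card_powersetCard_not_sparse (s : ℕ) (W : Finset α) (k : ℕ) :
    ((W.powersetCard (k + 1)).filter (fun A => ¬ Sparse (s + 1) W A)).card ≤
      s * W.card.choose k := by
  induction W using Finset.induction_on_max generalizing k with
  | empty =>
    rw [Finset.powersetCard_eq_empty.2 (by simp)]
    simp
  | insert m W hm ih =>
    have hmW : m ∉ W := fun h => lt_irrefl _ (hm m h)
    rw [Finset.card_insert_of_notMem hmW]
    -- For a small ground set, all `(k + 1)`-subsets together already satisfy the bound, by the
    -- ratio of consecutive binomial coefficients.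
    by_cases hn : W.card + 1 < (s + 1) * (k + 1)
    · refine (Finset.card_filter_le _ _).trans ?_
      rw [Finset.card_powersetCard, Finset.card_insert_of_notMem hmW]
      have h1 := Nat.choose_succ_right_eq (W.card + 1) k
      have h2 : W.card + 1 - k ≤ s * (k + 1) := by
        have : (s + 1) * (k + 1) = s * (k + 1) + k + 1 := by ring
        omega
      refine Nat.le_of_mul_le_mul_right (c := k + 1) ?_ (by omega)
      calc _ = (W.card + 1).choose k * (W.card + 1 - k) := h1
        _ ≤ (W.card + 1).choose k * (s * (k + 1)) := Nat.mul_le_mul_left _ h2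
        _ = _ := by ring
    push Not at hn
    have key : ∀ A : Finset α, A ⊆ W → Sparse (s + 1) W A → Sparse (s + 1) (insert m W) A := by
      intro A hA h x hx
      refine (h x hx).trans (Finset.card_le_card ?_)
      exact Finset.filter_subset_filter _ (Finset.subset_insert _ _)
    have key' : ∀ A : Finset α, A ⊆ W → A.card = k → Sparse (s + 1) W A →
        Sparse (s + 1) (insert m W) (insert m A) := by
      intro A hA hAk h x hx
      rcases Finset.mem_insert.1 hx with rfl | hx
      · rw [Finset.filter_true_of_mem, Finset.filter_true_of_mem,
          Finset.card_insert_of_notMem hmW,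
          Finset.card_insert_of_notMem fun h => hmW (hA h), hAk]
        · exact hn
        · intro y hy
          rcases Finset.mem_insert.1 hy with rfl | hy
          exacts [le_rfl, (hm y hy).le]
        · intro y hy
          rcases Finset.mem_insert.1 hy with rfl | hy
          exacts [le_rfl, (hm y (hA hy)).le]
      · rw [Finset.filter_insert, if_neg (not_le.2 (hm x (hA hx)))]
        exact key A hA h x hx
    rw [Finset.powersetCard_succ_insert hmW, Finset.filter_union]
    have h1 : ((W.powersetCard (k + 1)).filter fun A => ¬ Sparse (s + 1) (insert m W) A).card ≤
        s * W.card.choose k := by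
      refine (Finset.card_le_card fun A hA => ?_).trans (ih k)
      rw [Finset.mem_filter] at hA ⊢
      exact ⟨hA.1, fun h => hA.2 (key A (Finset.mem_powersetCard.1 hA.1).1 h)⟩
    have h2 : (((W.powersetCard k).image (insert m)).filter
        fun A => ¬ Sparse (s + 1) (insert m W) A).card ≤
        ((W.powersetCard k).filter (fun A => ¬ Sparse (s + 1) W A)).card := by
      refine (Finset.card_le_card (t := ((W.powersetCard k).filter
        (fun A => ¬ Sparse (s + 1) W A)).image (insert m)) fun A hA => ?_).trans
        Finset.card_image_le
      rw [Finset.mem_filter] at hA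
      obtain ⟨B, hB, rfl⟩ := Finset.mem_image.1 hA.1
      refine Finset.mem_image_of_mem _ (Finset.mem_filter.2 ⟨hB, fun h => hA.2 ?_⟩)
      rw [Finset.mem_powersetCard] at hB
      exact key' B hB.1 hB.2 h
    refine (Finset.card_union_le _ _).trans ((add_le_add h1 h2).trans ?_)
    cases k with
    | zero => simp [Sparse]
    | succ k =>
      rw [Nat.choose_succ_succ', mul_add]
      have := ih k
      omega

/-- The number of elements of `W` below `x`. -/
def rankIn (W : Finset α) (x : α) : ℕ := (W.filter (· < x)).card

theorem rankIn_injOn (W : Finset α) : Set.InjOn (rankIn W) (W : Set α) := by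
  have lt : ∀ x ∈ W, ∀ y, x < y → rankIn W x < rankIn W y := by
    intro x hx y hxy
    refine Finset.card_lt_card ⟨fun z hz => ?_, fun hsub => ?_⟩
    · rw [Finset.mem_filter] at hz ⊢
      exact ⟨hz.1, hz.2.trans hxy⟩
    · have : x ∈ W.filter (· < x) := hsub (Finset.mem_filter.2 ⟨hx, hxy⟩)
      simp at this
  intro x hx y hy h
  rcases lt_trichotomy x y with hxy | hxy | hxy
  · exact absurd h (lt x hx y hxy).ne
  · exact hxy
  · exact absurd h (lt y hy x hxy).ne'

theorem exists_rankIn_eq {W : Finset α} {n : ℕ} (hn : n < W.card) :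
    ∃ x ∈ W, rankIn W x = n := by
  have h : W.image (rankIn W) = Finset.range W.card := by
    refine Finset.eq_of_subset_of_card_le (fun n hn => ?_) ?_
    · obtain ⟨x, hx, rfl⟩ := Finset.mem_image.1 hn
      refine Finset.mem_range.2 (Finset.card_lt_card ⟨Finset.filter_subset _ _, fun hsub => ?_⟩)
      simpa using hsub hx
    · rw [Finset.card_image_of_injOn (rankIn_injOn W), Finset.card_range]
  have := Finset.mem_range.2 hn
  rwa [← h, Finset.mem_image] at this

/-- The first `m` elements of `W` whose rank is congruent to `r` modulo `q`. -/
def residueSet (W : Finset α) (q r m : ℕ) : Finset α :=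
  W.filter fun y => rankIn W y % q = r ∧ rankIn W y / q < m

theorem card_residueSet_le (W : Finset α) (q r m : ℕ) : (residueSet W q r m).card ≤ m := by
  rw [← Finset.card_range m]
  refine Finset.card_le_card_of_injOn (fun y => rankIn W y / q) (fun y hy => ?_) ?_
  · simpa using (Finset.mem_filter.1 hy).2.2
  · intro y hy z hz h
    have hy' := Finset.mem_filter.1 (Finset.mem_coe.1 hy)
    have hz' := Finset.mem_filter.1 (Finset.mem_coe.1 hz)
    refine rankIn_injOn W hy'.1 hz'.1 ?_
    rw [← Nat.div_add_mod (rankIn W y) q, ← Nat.div_add_mod (rankIn W z) q, hy'.2.1, hz'.2.1]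
    dsimp only at h
    rw [h]

/-- Ranks start at `0`, so `r, q + r, …, (c - 1) q + r` all lie among the first `q * c` ranks. -/
theorem le_card_residueSet_filter {W : Finset α} {q r m c : ℕ} (hr : r < q) (hcm : c ≤ m) {x : α}
    (hc : q * c ≤ (W.filter (· ≤ x)).card) :
    c ≤ ((residueSet W q r m).filter (· ≤ x)).card := by
  have lt : ∀ a, a < c → q * a + r < (W.filter (· ≤ x)).card := fun a ha => by
    have : q * (a + 1) ≤ q * c := Nat.mul_le_mul_left _ ha
    rw [mul_add] at this
    omega
  have ex : ∀ a : Fin c, ∃ y ∈ W, rankIn W y = q * a + r := fun a =>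
    exists_rankIn_eq ((lt a a.2).trans_le (Finset.card_filter_le _ _))
  choose g hgW hg using ex
  have hq : 0 < q := by omega
  rw [← Fintype.card_fin c, ← Finset.card_univ]
  refine Finset.card_le_card_of_injOn g (fun a _ => ?_) fun a _ b _ h => ?_
  · simp only [residueSet, Finset.coe_filter, Finset.mem_filter, Set.mem_ofPred_eq]
    refine ⟨⟨hgW a, ?_, ?_⟩, ?_⟩
    · rw [hg, Nat.mul_add_mod, Nat.mod_eq_of_lt hr]
    · rw [hg, Nat.mul_add_div hq, Nat.div_eq_of_lt hr]
      have := a.2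
      omega
    · by_contra hx
      rw [not_le] at hx
      have h1 : (W.filter (· ≤ x)).card ≤ rankIn W (g a) := Finset.card_le_card fun z hz => by
        rw [Finset.mem_filter] at hz ⊢
        exact ⟨hz.1, hz.2.trans_lt hx⟩
      rw [hg] at h1
      exact absurd (lt a a.2) (not_lt.2 h1)
  · have h1 : q * (a : ℕ) + r = q * b + r := by rw [← hg, ← hg, h]
    exact Fin.ext (Nat.eq_of_mul_eq_mul_left hq (by omega))

/-- Sparsity speaks only of elements of `A`, so the count is read off at the largest element of `A`
not above `z`. The result is the domination that `Shifted.mem_of_dominated` asks for. -/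
theorem Sparse.card_filter_le {q r : ℕ} {W A : Finset α} (h : Sparse q W A) (hr : r < q) (z : α) :
    (A.filter (· ≤ z)).card ≤ ((residueSet W q r A.card).filter (· ≤ z)).card := by
  rcases (A.filter (· ≤ z)).eq_empty_or_nonempty with h0 | hne
  · simp [h0]
  have hy := Finset.max'_mem _ hne
  set y := (A.filter (· ≤ z)).max' hne
  rw [Finset.mem_filter] at hy
  have : A.filter (· ≤ z) = A.filter (· ≤ y) := by
    ext a
    simp only [Finset.mem_filter]
    exact ⟨fun ha => ⟨ha.1, Finset.le_max' _ _ (Finset.mem_filter.2 ha)⟩,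
      fun ha => ⟨ha.1, ha.2.trans hy.2⟩⟩
  rw [this]
  refine (le_card_residueSet_filter hr (Finset.card_filter_le _ _) (h y hy.1)).trans
    (Finset.card_le_card fun a ha => ?_)
  rw [Finset.mem_filter] at ha ⊢
  exact ⟨ha.1, ha.2.trans hy.2⟩

theorem Sparse.card_residueSet {q r : ℕ} {W A : Finset α} (h : Sparse q W A) (hr : r < q) :
    (residueSet W q r A.card).card = A.card := by
  refine le_antisymm (card_residueSet_le _ _ _ _) ?_
  rcases A.eq_empty_or_nonempty with h0 | hne
  · simp [h0]
  have := h.card_filter_le hr (A.max' hne)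
  rw [Finset.filter_true_of_mem fun a ha => Finset.le_max' _ _ ha] at this
  exact this.trans (Finset.card_filter_le _ _)

variable {l : ℕ} {V : Fin l → Finset α} {k : Fin l → ℕ}

/-- In a shifted family, edges meeting `T` in the various single vertices of `T` and sparse
outside `T` can be made disjoint. -/
theorem hasMatching_of_transversal (hV : ∀ i j, i ≠ j → Disjoint (V i) (V j))
    {F : Finset (Finset α)} (hF : F ⊆ layer V k) (hsh : Shifted V F) {T : Finset α}
    (hT : ∀ v ∈ T, ∃ E ∈ F, E ∩ T = {v} ∧ ∀ j, Sparse T.card (V j \ T) (E ∩ (V j \ T))) :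
    HasMatching F T.card := by
  have hT' : ∀ r : Fin T.card, ∃ E ∈ F, E ∩ T = {(T.equivFin.symm r : α)} ∧
    ∀ j, Sparse T.card (V j \ T) (E ∩ (V j \ T)) := fun r => hT _ (T.equivFin.symm r).2
  choose E hEF hET hES using hT'
  have hW : ∀ i j, i ≠ j → Disjoint (V i \ T) (V j \ T) := fun i j hij =>
    (hV i j hij).mono Finset.sdiff_subset Finset.sdiff_subset
  have hshW : Shifted (fun j => V j \ T) F := fun j x hx y hy =>
    hsh j x (Finset.sdiff_subset hx) y (Finset.sdiff_subset hy)
  -- Each vertex of `T` receives its own residue class modulo `T.card`, which makes the new edges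
  -- disjoint. Shifting takes place only in the blocks `V j \ T`, so the vertices of `T` stay in
  -- place.
  let R : Fin T.card → Fin l → Finset α := fun r j =>
    residueSet (V j \ T) T.card r (E r ∩ (V j \ T)).card
  have hRW : ∀ r j, R r j ⊆ V j \ T := fun r j => Finset.filter_subset _ _
  have hRT : ∀ r, ∀ x ∈ T, x ∉ Finset.univ.biUnion (R r) := by
    intro r x hx h
    obtain ⟨j, -, hj⟩ := Finset.mem_biUnion.1 h
    exact (Finset.mem_sdiff.1 (hRW r j hj)).2 hx
  have hinter : ∀ r j, insert (T.equivFin.symm r : α) (Finset.univ.biUnion (R r)) ∩ (V j \ T) =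
      R r j := by
    intro r j
    rw [Finset.insert_inter_of_notMem (by simp), biUnion_inter_part hW (hRW r)]
  refine ⟨fun r => insert (T.equivFin.symm r : α) (Finset.univ.biUnion (R r)), fun r => ?_,
    fun r r' hrr => ?_⟩
  · refine hshW.mem_of_dominated hW _ _ (E r) le_rfl (hEF r) ?_ ?_ ?_
    · intro a ha
      have h1 : a ∉ Finset.univ.biUnion (R r) := fun h => by
        obtain ⟨j, -, hj⟩ := Finset.mem_biUnion.1 h
        exact ha j (hRW r j hj)
      have h2 : a ∈ E r ↔ a ∈ E r ∩ T := by
        refine ⟨fun h => Finset.mem_inter.2 ⟨h, ?_⟩, fun h => (Finset.mem_inter.1 h).1⟩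
        obtain ⟨j, hj⟩ := (mem_layer.1 (hF (hEF r))).1 a h
        by_contra haT
        exact ha j (Finset.mem_sdiff.2 ⟨hj, haT⟩)
      rw [h2, hET]
      simp only [Finset.mem_insert, Finset.mem_singleton, h1, or_false]
    · intro j
      rw [hinter]
      exact ((hES r j).card_residueSet r.2).symm
    · intro j z
      rw [hinter]
      exact (hES r j).card_filter_le r.2 z
  · rw [Finset.disjoint_insert_left, Finset.disjoint_insert_right]
    refine ⟨?_, hRT r _ (T.equivFin.symm r').2, ?_⟩
    · rw [Finset.mem_insert, not_or]
      refine ⟨fun h => hrr (T.equivFin.symm.injective (Subtype.ext h)),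
        hRT r' _ (T.equivFin.symm r).2⟩
    · refine Finset.disjoint_left.2 fun x hx hx' => ?_
      obtain ⟨j, -, hj⟩ := Finset.mem_biUnion.1 hx
      obtain ⟨j', -, hj'⟩ := Finset.mem_biUnion.1 hx'
      have hjj : j = j' := by
        by_contra h
        exact Finset.disjoint_left.1 (hW j j' h) (hRW r j hj) (hRW r' j' hj')
      subst hjj
      exact hrr (Fin.ext ((Finset.mem_filter.1 hj).2.1.symm.trans (Finset.mem_filter.1 hj').2.1))

end Sparse

/-! ### Degree estimates in the layer -/

section Density

variable {α : Type*} {l : ℕ} {V : Fin l → Finset α} {k : Fin l → ℕ}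

/-- The size of the layer, as a real number. -/
noncomputable def edgeCount (V : Fin l → Finset α) (k : Fin l → ℕ) : ℝ :=
  ∏ j, ((V j).card.choose (k j) : ℝ)

/-- The proportion of members of the layer that contain a given element of `V j`. -/
noncomputable def density (V : Fin l → Finset α) (k : Fin l → ℕ) (j : Fin l) : ℝ :=
  k j / (V j).card

theorem edgeCount_nonneg : 0 ≤ edgeCount V k := Finset.prod_nonneg fun _ _ => Nat.cast_nonneg _

theorem density_nonneg (j : Fin l) : 0 ≤ density V k j := by unfold density; positivity

/-- The size hypothesis in the form used for covers: `s` edges have `s * k j` vertices in `V j`, and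
summing over the `l` blocks leaves `1 / (4 l)`. -/
theorem mul_density_le {s : ℕ} {j : Fin l} (hn : 4 * l ^ 2 * k j ^ 2 * s ≤ (V j).card) :
    s * k j * density V k j ≤ 1 / (4 * (l : ℝ) ^ 2) := by
  have hl : (0 : ℝ) < l := by exact_mod_cast (by have := j.2; omega : 0 < l)
  rcases Nat.eq_zero_or_pos (V j).card with h0 | hpos
  · rw [density, h0]
    simp
  have hpos' : (0 : ℝ) < (V j).card := by exact_mod_cast hpos
  have hn' : 4 * (l : ℝ) ^ 2 * k j ^ 2 * s ≤ (V j).card := by exact_mod_cast hn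
  rw [density, ← mul_div_assoc, div_le_div_iff₀ hpos' (by positivity)]
  linarith

variable [LinearOrder α]

theorem card_filter_mem_le {i : Fin l} {v : α} (hv : v ∈ V i) :
    (((layer V k).filter (fun E => v ∈ E)).card : ℝ) ≤ edgeCount V k * density V k i := by
  have := card_le_density (𝒜 := (layer V k).filter (fun E => v ∈ E)) (Finset.filter_subset _ _)
    (B := fun j => ((V j).powersetCard (k j)).filter (fun A => j = i → v ∈ A))
    (fun E hE j => ?_) i i (density V k i) 1 (fun j => ?_)
  · rwa [mul_one] at this
  · rw [Finset.mem_filter] at hE ⊢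
    exact ⟨inter_mem_powersetCard hE.1 j, fun h => Finset.mem_inter.2 ⟨hE.2, h ▸ hv⟩⟩
  · by_cases h : j = i
    · subst h
      simp only [true_imp_iff, if_true, mul_one]
      exact (card_powersetCard_filter_mem hv _).le
    · simp [h]

theorem card_filter_mem_mem_le {i i' : Fin l} (hk : k i ≤ (V i).card) {u v : α} (hv : v ∈ V i)
    (hu : u ∈ V i') (huv : u ≠ v) :
    (((layer V k).filter (fun E => v ∈ E ∧ u ∈ E)).card : ℝ) ≤
      edgeCount V k * (density V k i * density V k i') := by
  refine card_le_density (𝒜 := (layer V k).filter (fun E => v ∈ E ∧ u ∈ E))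
    (Finset.filter_subset _ _)
    (B := fun j => ((V j).powersetCard (k j)).filter (fun A => (j = i → v ∈ A) ∧ (j = i' → u ∈ A)))
    (fun E hE j => ?_) i i' (density V k i) (density V k i') (fun j => ?_)
  · rw [Finset.mem_filter] at hE ⊢
    exact ⟨inter_mem_powersetCard hE.1 j, fun h => Finset.mem_inter.2 ⟨hE.2.1, h ▸ hv⟩,
      fun h => Finset.mem_inter.2 ⟨hE.2.2, h ▸ hu⟩⟩
  · by_cases h : j = i <;> by_cases h' : j = i'
    · subst h; subst h'
      simp only [true_imp_iff, if_true]
      exact card_powersetCard_filter_mem_mem hv hu huv hk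
    · subst h
      simp only [true_imp_iff, if_true, h', false_imp_iff, and_true, if_false, mul_one]
      exact (card_powersetCard_filter_mem hv _).le
    · subst h'
      simp only [true_imp_iff, if_true, h, false_imp_iff, true_and, if_false, one_mul]
      exact (card_powersetCard_filter_mem hu _).le
    · simp [h, h']

/-- Since `binom(m, κ) (m - κ) = binom(m, κ + 1) (κ + 1)` and `m - κ ≥ 3 n / 4`, the loss is the
factor `4/3`, which absorbs the removal of `T` from a block. -/
theorem choose_le_choose_succ_mul {m N n κ : ℕ} (hmN : m ≤ N) (hn : 0 < n)
    (h : 3 * n + 4 * κ ≤ 4 * m) :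
    (m.choose κ : ℝ) ≤ (N.choose (κ + 1) : ℝ) * (4 / 3 * ((κ + 1 : ℕ) / n)) := by
  have h1 : (m.choose (κ + 1) : ℝ) * ((κ + 1 : ℕ) : ℝ) = m.choose κ * ((m : ℝ) - κ) := by
    rw [← Nat.cast_sub (by omega)]
    exact_mod_cast Nat.choose_succ_right_eq m κ
  have h2 : (m.choose (κ + 1) : ℝ) ≤ N.choose (κ + 1) := by
    exact_mod_cast Nat.choose_le_choose _ hmN
  have h3 : (3 : ℝ) * n + 4 * κ ≤ 4 * m := by exact_mod_cast h
  have hn' : (0 : ℝ) < n := by exact_mod_cast hn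
  have h4 : (0 : ℝ) ≤ m.choose κ := Nat.cast_nonneg _
  have h5 : (m.choose κ : ℝ) * (3 / 4 * n) ≤ N.choose (κ + 1) * ((κ + 1 : ℕ) : ℝ) := by
    calc (m.choose κ : ℝ) * (3 / 4 * n) ≤ m.choose κ * ((m : ℝ) - κ) :=
          mul_le_mul_of_nonneg_left (by linarith) h4
      _ = _ := h1.symm
      _ ≤ _ := mul_le_mul_of_nonneg_right h2 (Nat.cast_nonneg _)
  have h6 : (N.choose (κ + 1) : ℝ) * (4 / 3 * ((κ + 1 : ℕ) / n)) =
      N.choose (κ + 1) * ((κ + 1 : ℕ) : ℝ) / (3 / 4 * n) := by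
    field_simp
  rw [h6, le_div_iff₀ (by positivity)]
  exact h5

theorem four_mul_add_le {κ s n : ℕ} (hs : 1 ≤ s) (hn : 4 * (κ + 1) ^ 2 * s ≤ n) :
    4 * (s + κ) ≤ n := by
  obtain ⟨t, rfl⟩ : ∃ t, s = t + 1 := ⟨s - 1, by omega⟩
  nlinarith [Nat.zero_le (κ ^ 2 * t), Nat.zero_le (κ * t), Nat.zero_le (κ ^ 2)]

/-- Passing through `v` costs a factor `d i`, and failing to be sparse in `V j` a further `4/3 * s *
d j`. Both conditions may fall on the same block, hence the case `j = i`. -/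
theorem card_filter_not_sparse_le {s : ℕ} (hs : 1 ≤ s)
    (hn : ∀ j, 4 * k j ^ 2 * s ≤ (V j).card) (hV : ∀ i j, i ≠ j → Disjoint (V i) (V j))
    {T : Finset α} (hT : T.card = s + 1) {v : α} (hvT : v ∈ T) {i : Fin l} (hv : v ∈ V i)
    (j : Fin l) :
    (((layer V k).filter
      (fun E => E ∩ T = {v} ∧ ¬ Sparse (s + 1) (V j \ T) (E ∩ (V j \ T)))).card : ℝ) ≤
      edgeCount V k * (density V k i * (4 / 3 * s * density V k j)) := by
  refine card_le_density (Finset.filter_subset _ _)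
    (B := fun j' => ((V j').powersetCard (k j')).filter (fun A => (j' = i → v ∈ A) ∧
      (j' = j → A ∩ T ⊆ {v} ∧ ¬ Sparse (s + 1) (V j \ T) (A ∩ (V j \ T)))))
    (fun E hE j' => ?_) i j (density V k i) (4 / 3 * s * density V k j) (fun j' => ?_)
  · rw [Finset.mem_filter] at hE ⊢
    refine ⟨inter_mem_powersetCard hE.1 j', fun h => Finset.mem_inter.2 ⟨?_, h ▸ hv⟩, fun h => ?_⟩
    · have : v ∈ E ∩ T := by rw [hE.2.1]; simp
      exact (Finset.mem_inter.1 this).1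
    · subst h
      rw [Finset.inter_assoc E (V j') (V j' \ T),
        Finset.inter_eq_right.2 (Finset.sdiff_subset (s := V j') (t := T))]
      exact ⟨hE.2.1 ▸ Finset.inter_subset_inter_right Finset.inter_subset_left, hE.2.2⟩
  by_cases hj : j' = j
  swap
  · by_cases h : j' = i
    · subst h
      simp only [true_imp_iff, if_true, hj, false_imp_iff, and_true, if_false, mul_one]
      exact (card_powersetCard_filter_mem hv _).le
    · simp [h, hj]
  subst hj
  simp only [true_imp_iff, if_true]
  by_cases h : j' = i
  · subst h
    simp only [true_imp_iff, if_true]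
    -- When `v` lies in this block, the trace outside `T` is the trace with `v` erased, so it
    -- determines the trace and has one element fewer.
    have hle : (((V j').powersetCard (k j')).filter (fun A => v ∈ A ∧ A ∩ T ⊆ {v} ∧
        ¬ Sparse (s + 1) (V j' \ T) (A ∩ (V j' \ T)))).card ≤
        (((V j' \ T).powersetCard (k j' - 1)).filter
          (fun A => ¬ Sparse (s + 1) (V j' \ T) A)).card := by
      have her : ∀ A ∈ ((V j').powersetCard (k j')).filter (fun A => v ∈ A ∧ A ∩ T ⊆ {v} ∧
        ¬ Sparse (s + 1) (V j' \ T) (A ∩ (V j' \ T))), A ∩ (V j' \ T) = A.erase v := by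
        intro A hA
        simp only [Finset.mem_filter, Finset.mem_powersetCard] at hA
        ext x
        simp only [Finset.mem_inter, Finset.mem_sdiff, Finset.mem_erase]
        constructor
        · rintro ⟨h1, h2, h3⟩
          exact ⟨fun h => h3 (h ▸ hvT), h1⟩
        · rintro ⟨h1, h2⟩
          refine ⟨h2, hA.1.1 h2, fun h3 => h1 ?_⟩
          simpa using hA.2.2.1 (Finset.mem_inter.2 ⟨h2, h3⟩)
      refine Finset.card_le_card_of_injOn (fun A => A ∩ (V j' \ T)) (fun A hA => ?_) ?_
      · have h1 := her A hA
        simp only [Finset.coe_filter, Set.mem_ofPred_eq, Finset.mem_powersetCard] at hA ⊢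
        refine ⟨⟨Finset.inter_subset_right, ?_⟩, hA.2.2.2⟩
        rw [h1, Finset.card_erase_of_mem hA.2.1, hA.1.2]
      · intro A hA A' hA' hAA
        dsimp only at hAA
        rw [her A hA, her A' hA'] at hAA
        rw [← Finset.insert_erase (Finset.mem_filter.1 hA).2.1, hAA,
          Finset.insert_erase (Finset.mem_filter.1 hA').2.1]
    refine (Nat.cast_le.2 hle).trans ?_
    -- For `k j' ≤ 1` (with truncated `0 - 1 = 0`) only the empty set remains, and it is sparse.
    rcases hk : k j' with _ | _ | κ
    · simp [Sparse, density, hk]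
    · simp only [zero_add, Nat.sub_self, Finset.powersetCard_zero]
      have : (({∅} : Finset (Finset α)).filter
          (fun A => ¬ Sparse (s + 1) (V j' \ T) A)) = ∅ := by
        simp [Finset.filter_singleton, Sparse]
      rw [this, Finset.card_empty, Nat.cast_zero]
      have := density_nonneg (V := V) (k := k) j'
      positivity
    · have hnj := hn j'
      rw [hk] at hnj
      have h4 := four_mul_add_le hs hnj
      have hm1 : (V j').card ≤ (V j' \ T).card + (s + 1) := by
        rw [← hT]
        exact Finset.card_le_card_sdiff_add_card
      have hm2 : (V j' \ T).card ≤ (V j').card - 1 := by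
        rw [← Finset.card_erase_of_mem hv]
        refine Finset.card_le_card fun x hx => ?_
        rw [Finset.mem_sdiff] at hx
        exact Finset.mem_erase.2 ⟨fun h => hx.2 (h ▸ hvT), hx.1⟩
      have hpos : 0 < (V j').card := Finset.card_pos.2 ⟨v, hv⟩
      have h5 := choose_le_choose_succ_mul (κ := κ) (n := (V j').card) hm2 hpos (by omega)
      have h6 : (((V j').card - 1).choose (κ + 1) : ℝ) =
          (V j').card.choose (κ + 2) * density V k j' := by
        have := Nat.add_one_mul_choose_eq ((V j').card - 1) (κ + 1)
        rw [Nat.sub_add_cancel hpos] at this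
        have h7 : ((V j').card : ℝ) * (((V j').card - 1).choose (κ + 1) : ℝ) =
          (V j').card.choose (κ + 2) * ((κ + 2 : ℕ) : ℝ) := by exact_mod_cast this
        rw [density, hk]
        have : ((V j').card : ℝ) ≠ 0 := by exact_mod_cast hpos.ne'
        field_simp
        linarith
      have h8 : (((κ + 1 : ℕ) : ℝ) / (V j').card) ≤ density V k j' := by
        rw [density, hk]
        gcongr
        simp
      have h9 : ((((V j' \ T).powersetCard (κ + 1)).filter
          (fun A => ¬ Sparse (s + 1) (V j' \ T) A)).card : ℝ) ≤
          s * (V j' \ T).card.choose κ := by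
        exact_mod_cast card_powersetCard_not_sparse s (V j' \ T) κ
      have hd := density_nonneg (V := V) (k := k) j'
      calc _ ≤ (s : ℝ) * (V j' \ T).card.choose κ := h9
        _ ≤ s * (((V j').card.choose (κ + 2) * density V k j') *
            (4 / 3 * density V k j')) := by
          rw [← h6]
          exact mul_le_mul_of_nonneg_left (h5.trans (by gcongr)) (Nat.cast_nonneg _)
        _ = _ := by ring
  · simp only [h, false_imp_iff, true_and, if_false, one_mul]
    have hvj : v ∉ V j' := fun hvj => Finset.disjoint_left.1 (hV j' i h) hvj hv
    have hle : (((V j').powersetCard (k j')).filter (fun A => A ∩ T ⊆ {v} ∧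
        ¬ Sparse (s + 1) (V j' \ T) (A ∩ (V j' \ T)))).card ≤
        (((V j' \ T).powersetCard (k j')).filter
          (fun A => ¬ Sparse (s + 1) (V j' \ T) A)).card := by
      refine Finset.card_le_card fun A hA => ?_
      simp only [Finset.mem_filter, Finset.mem_powersetCard] at hA ⊢
      have hsub : A ⊆ V j' \ T := fun x hx => Finset.mem_sdiff.2 ⟨hA.1.1 hx, fun hxT => by
        have : x = v := by simpa using hA.2.1 (Finset.mem_inter.2 ⟨hx, hxT⟩)
        exact hvj (this ▸ hA.1.1 hx)⟩
      rw [Finset.inter_eq_left.2 hsub] at hA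
      exact ⟨⟨hsub, hA.1.2⟩, hA.2.2⟩
    refine (Nat.cast_le.2 hle).trans ?_
    rcases hk : k j' with _ | κ
    · simp [Sparse, density, hk, Finset.filter_singleton]
    · have hnj := hn j'
      rw [hk] at hnj
      have h4 := four_mul_add_le hs hnj
      have hm1 : (V j').card ≤ (V j' \ T).card + s := by
        have h1 : (V j' \ T) = V j' \ T.erase v := by
          ext x
          simp only [Finset.mem_sdiff, Finset.mem_erase, not_and]
          refine and_congr_right fun hx => ⟨fun h _ => h, fun h => h fun hxv => hvj (hxv ▸ hx)⟩
        have h2 : (T.erase v).card = s := by rw [Finset.card_erase_of_mem hvT, hT]; rfl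
        rw [h1, ← h2]
        exact Finset.card_le_card_sdiff_add_card
      have h5 := choose_le_choose_succ_mul (κ := κ) (n := (V j').card)
        (Finset.card_le_card (Finset.sdiff_subset (s := V j') (t := T))) (by omega) (by omega)
      have h9 : ((((V j' \ T).powersetCard (κ + 1)).filter
          (fun A => ¬ Sparse (s + 1) (V j' \ T) A)).card : ℝ) ≤
          s * (V j' \ T).card.choose κ := by
        exact_mod_cast card_powersetCard_not_sparse s (V j' \ T) κ
      rw [density, hk]
      calc _ ≤ (s : ℝ) * (V j' \ T).card.choose κ := h9
        _ ≤ _ := mul_le_mul_of_nonneg_left h5 (Nat.cast_nonneg _)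
        _ = _ := by ring

/-- A vertex of large degree lies in an edge meeting `T` only there and sparse outside `T`. -/
theorem exists_sparse_edge {s : ℕ} (hs : 1 ≤ s)
    (hn : ∀ j, 4 * k j ^ 2 * s ≤ (V j).card) (hV : ∀ i j, i ≠ j → Disjoint (V i) (V j))
    {F : Finset (Finset α)} (hF : F ⊆ layer V k) {p : ℝ} (hp : ∀ j, density V k j ≤ p)
    {T : Finset α} (hT : T.card = s + 1) (hTV : ∀ u ∈ T, ∃ j, u ∈ V j)
    {v : α} (hvT : v ∈ T) {i : Fin l} (hv : v ∈ V i)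
    (hdeg : edgeCount V k * (density V k i * (7 / 3 * s * l * p)) <
      (F.filter (fun E => v ∈ E)).card) :
    ∃ E ∈ F, E ∩ T = {v} ∧ ∀ j, Sparse (s + 1) (V j \ T) (E ∩ (V j \ T)) := by
  by_contra hcon
  push Not at hcon
  have hP := edgeCount_nonneg (V := V) (k := k)
  have hd := density_nonneg (V := V) (k := k) i
  have hp0 : 0 ≤ p := hd.trans (hp i)
  have hki : k i ≤ (V i).card := by
    refine le_trans ?_ (hn i)
    nlinarith [Nat.zero_le (k i), Nat.le_self_pow (two_ne_zero) (k i)]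
  -- An edge through `v` fails either by containing one of the `s` other vertices of `T` or by being
  -- non-sparse in one of the `l` blocks. In units of `P * d i` the costs are `s * p` and `l * (4/3
  -- * s * p)`, together at most `7/3 * s * l * p`.
  have hsub : F.filter (fun E => v ∈ E) ⊆
      ((T.erase v).biUnion fun u => (layer V k).filter (fun E => v ∈ E ∧ u ∈ E)) ∪
      (Finset.univ.biUnion fun j => (layer V k).filter
        (fun E => E ∩ T = {v} ∧ ¬ Sparse (s + 1) (V j \ T) (E ∩ (V j \ T)))) := by
    intro E hE
    rw [Finset.mem_filter] at hE
    rw [Finset.mem_union]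
    by_cases hET : E ∩ T = {v}
    · obtain ⟨j, hj⟩ := hcon E hE.1 hET
      exact Or.inr (Finset.mem_biUnion.2 ⟨j, Finset.mem_univ j,
        Finset.mem_filter.2 ⟨hF hE.1, hET, hj⟩⟩)
    · left
      obtain ⟨u, hu, huv⟩ : ∃ u ∈ E ∩ T, u ≠ v := by
        by_contra h
        push Not at h
        exact hET (Finset.eq_singleton_iff_unique_mem.2 ⟨Finset.mem_inter.2 ⟨hE.2, hvT⟩, h⟩)
      rw [Finset.mem_inter] at hu
      exact Finset.mem_biUnion.2 ⟨u, Finset.mem_erase.2 ⟨huv, hu.2⟩,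
        Finset.mem_filter.2 ⟨hF hE.1, hE.2, hu.1⟩⟩
  have h1 := (Finset.card_le_card hsub).trans ((Finset.card_union_le _ _).trans
    (add_le_add Finset.card_biUnion_le Finset.card_biUnion_le))
  have h2 : ((F.filter (fun E => v ∈ E)).card : ℝ) ≤
      ∑ u ∈ T.erase v, (((layer V k).filter (fun E => v ∈ E ∧ u ∈ E)).card : ℝ) +
      ∑ j, (((layer V k).filter
        (fun E => E ∩ T = {v} ∧ ¬ Sparse (s + 1) (V j \ T) (E ∩ (V j \ T)))).card : ℝ) := by
    exact_mod_cast h1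
  have h3 : ∑ u ∈ T.erase v, (((layer V k).filter (fun E => v ∈ E ∧ u ∈ E)).card : ℝ) ≤
      s * (edgeCount V k * (density V k i * p)) := by
    have h2 : (T.erase v).card = s := by rw [Finset.card_erase_of_mem hvT, hT]; rfl
    rw [← h2, ← nsmul_eq_mul]
    refine Finset.sum_le_card_nsmul _ _ _ fun u hu => ?_
    rw [Finset.mem_erase] at hu
    obtain ⟨j, hj⟩ := hTV u hu.2
    refine (card_filter_mem_mem_le hki hv hj hu.1).trans ?_
    have := hp j
    gcongr
  have h4 : ∑ j, (((layer V k).filter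
      (fun E => E ∩ T = {v} ∧ ¬ Sparse (s + 1) (V j \ T) (E ∩ (V j \ T)))).card : ℝ) ≤
      l * (edgeCount V k * (density V k i * (4 / 3 * s * p))) := by
    have := Finset.sum_le_card_nsmul (Finset.univ : Finset (Fin l)) (fun j => (((layer V k).filter
      (fun E => E ∩ T = {v} ∧ ¬ Sparse (s + 1) (V j \ T) (E ∩ (V j \ T)))).card : ℝ))
      (edgeCount V k * (density V k i * (4 / 3 * s * p))) fun j _ => by
        refine (card_filter_not_sparse_le hs hn hV hT hvT hv j).trans ?_
        have := hp j
        gcongr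
    simpa using this
  have hl : (1 : ℝ) ≤ l := by exact_mod_cast (by have := i.2; omega : 1 ≤ l)
  have h5 : 0 ≤ edgeCount V k * (density V k i * (s * p)) := by positivity
  nlinarith [mul_le_mul_of_nonneg_right hl h5]

theorem card_cover_le {G : Finset (Finset α)} {U : Finset α}
    (h : ∀ E ∈ G, ∃ j, ∃ u ∈ U ∩ V j, u ∈ E) :
    (G.card : ℝ) ≤ ∑ j, ∑ u ∈ U ∩ V j, ((G.filter (fun E => u ∈ E)).card : ℝ) := by
  have hsub : G ⊆ Finset.univ.biUnion fun j => (U ∩ V j).biUnion fun u =>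
      G.filter (fun E => u ∈ E) := by
    intro E hE
    obtain ⟨j, u, hu, huE⟩ := h E hE
    exact Finset.mem_biUnion.2 ⟨j, Finset.mem_univ j, Finset.mem_biUnion.2
      ⟨u, hu, Finset.mem_filter.2 ⟨hE, huE⟩⟩⟩
  have : G.card ≤ ∑ j, ∑ u ∈ U ∩ V j, (G.filter (fun E => u ∈ E)).card :=
    (Finset.card_le_card hsub).trans (Finset.card_biUnion_le.trans
      (Finset.sum_le_sum fun j _ => Finset.card_biUnion_le))
  exact_mod_cast this

theorem card_biUnion_inter_le {r s : ℕ} (hrs : r ≤ s) {f : Fin r → Finset α}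
    (hf : ∀ a, f a ∈ layer V k) (j : Fin l) :
    ((Finset.univ.biUnion f ∩ V j).card : ℝ) ≤ s * k j := by
  have h : (Finset.univ.biUnion f ∩ V j).card ≤ r * k j := by
    rw [Finset.biUnion_inter]
    refine Finset.card_biUnion_le.trans ?_
    rw [Finset.sum_congr rfl fun a _ => (mem_layer.1 (hf a)).2 j]
    simp
  exact_mod_cast h.trans (Nat.mul_le_mul_right _ hrs)

/-- A matching avoiding a vertex of large degree extends by an edge through that vertex. -/
theorem exists_disjoint_edge {s : ℕ} (hs : 1 ≤ s)
    (hn : ∀ j, 4 * l ^ 2 * k j ^ 2 * s ≤ (V j).card)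
    {F : Finset (Finset α)} (hF : F ⊆ layer V k) {v : α} {i : Fin l} (hv : v ∈ V i)
    (hdeg : edgeCount V k * density V k i / (4 * l) < (F.filter (fun E => v ∈ E)).card)
    {f : Fin s → Finset α} (hf : ∀ a, f a ∈ F.filter (fun E => v ∉ E)) :
    ∃ E ∈ F, ∀ a, Disjoint E (f a) := by
  by_contra hcon
  push Not at hcon
  have hl1 : 1 ≤ l := by have := i.2; omega
  have hl : (0 : ℝ) < l := by exact_mod_cast hl1
  have hP := edgeCount_nonneg (V := V) (k := k)
  have hd := density_nonneg (V := V) (k := k)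
  have hki : k i ≤ (V i).card := by
    refine le_trans ?_ (hn i)
    calc k i ≤ k i ^ 2 := Nat.le_self_pow two_ne_zero _
      _ = 1 * 1 ^ 2 * k i ^ 2 * 1 := by ring
      _ ≤ 4 * l ^ 2 * k i ^ 2 * s := by gcongr; norm_num
  -- If every edge through `v` met the matching, its vertices would cover these edges, and pair
  -- degrees would bound the degree of `v` by `P * d i / (4 l)`.
  have hcov := card_cover_le (V := V) (G := F.filter (fun E => v ∈ E)) (U := Finset.univ.biUnion f)
    fun E hE => by
      rw [Finset.mem_filter] at hE
      obtain ⟨a, ha⟩ := hcon E hE.1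
      obtain ⟨u, huE, hua⟩ := Finset.not_disjoint_iff.1 ha
      obtain ⟨j, hj⟩ := (mem_layer.1 (hF hE.1)).1 u huE
      exact ⟨j, u, Finset.mem_inter.2 ⟨Finset.mem_biUnion.2 ⟨a, Finset.mem_univ a, hua⟩, hj⟩, huE⟩
  have hsum : ∀ j, ∑ u ∈ Finset.univ.biUnion f ∩ V j,
      (((F.filter (fun E => v ∈ E)).filter (fun E => u ∈ E)).card : ℝ) ≤
      edgeCount V k * density V k i * (1 / (4 * (l : ℝ) ^ 2)) := by
    intro j
    have h1 : ∀ u ∈ Finset.univ.biUnion f ∩ V j,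
        (((F.filter (fun E => v ∈ E)).filter (fun E => u ∈ E)).card : ℝ) ≤
        edgeCount V k * (density V k i * density V k j) := by
      intro u hu
      rw [Finset.mem_inter, Finset.mem_biUnion] at hu
      obtain ⟨⟨a, -, ha⟩, huj⟩ := hu
      have huv : u ≠ v := fun h => (Finset.mem_filter.1 (hf a)).2 (h ▸ ha)
      refine le_trans ?_ (card_filter_mem_mem_le hki hv huj huv)
      rw [Finset.filter_filter]
      exact_mod_cast Finset.card_le_card (Finset.filter_subset_filter _ hF)
    refine (Finset.sum_le_card_nsmul _ _ _ h1).trans ?_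
    rw [nsmul_eq_mul]
    have h2 := card_biUnion_inter_le (V := V) (k := k) le_rfl
      (fun a => hF (Finset.mem_filter.1 (hf a)).1) j
    have h3 := mul_density_le (hn j)
    have hdi := hd i
    have hdj := hd j
    calc _ ≤ (s * k j : ℝ) * (edgeCount V k * (density V k i * density V k j)) := by gcongr
      _ = edgeCount V k * density V k i * (s * k j * density V k j) := by ring
      _ ≤ _ := by gcongr
  have htot := hcov.trans (Finset.sum_le_sum fun j _ => hsum j)
  simp only [Finset.sum_const, Finset.card_univ, Fintype.card_fin, nsmul_eq_mul] at htot
  have : (l : ℝ) * (edgeCount V k * density V k i * (1 / (4 * (l : ℝ) ^ 2))) =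
      edgeCount V k * density V k i / (4 * l) := by
    field_simp
  linarith

end Density

/-! ### Ratios of binomial coefficients -/

section Arithmetic

/-- The ratio `binom(n - j - 1, k) / binom(n - j, k)`. -/
noncomputable def dropRatio (n k j : ℕ) : ℝ := 1 - k / ((n : ℝ) - j)

/-- A telescoping product. For `k = 0` every ratio is `1`, so truncation of `n - s` does no harm. -/
theorem cast_choose_sub {n k s : ℕ} (h : k = 0 ∨ s ≤ n) :
    ((n - s).choose k : ℝ) = n.choose k * ∏ j ∈ Finset.range s, dropRatio n k j := by
  rcases h with rfl | h
  · simp [dropRatio]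
  induction s with
  | zero => simp
  | succ s ih =>
    rw [Finset.prod_range_succ, ← mul_assoc, ← ih (by omega)]
    obtain ⟨m, rfl⟩ : ∃ m, n = m + 1 + s := ⟨n - (s + 1), by omega⟩
    rw [show m + 1 + s - (s + 1) = m by omega, show m + 1 + s - s = m + 1 by omega, dropRatio]
    have h1 := Nat.choose_mul_succ_eq m k
    push_cast
    have hm : (m : ℝ) + 1 ≠ 0 := by positivity
    rw [show (m : ℝ) + 1 + s - s = m + 1 by ring]
    rcases le_or_gt k (m + 1) with hk | hk
    · have h2 : (m.choose k : ℝ) * (m + 1) = (m + 1).choose k * ((m : ℝ) + 1 - k) := by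
        have h3 : ((m.choose k * (m + 1) : ℕ) : ℝ) = ((m + 1).choose k * (m + 1 - k) : ℕ) := by
          rw [h1]
        push_cast [Nat.cast_sub hk] at h3
        exact h3
      field_simp
      linarith
    · rw [Nat.choose_eq_zero_of_lt hk, Nat.choose_eq_zero_of_lt (by omega)]
      simp

theorem dropRatio_nonneg {n k s j : ℕ} (h : k = 0 ∨ k + s ≤ n) (hj : j < s) :
    0 ≤ dropRatio n k j := by
  rcases h with rfl | h
  · simp [dropRatio]
  · have h1 : (k : ℝ) + j ≤ n := by exact_mod_cast (by omega : k + j ≤ n)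
    rw [dropRatio, sub_nonneg]
    exact div_le_one_of_le₀ (by linarith) (by linarith [(Nat.cast_nonneg k : (0 : ℝ) ≤ k)])

theorem dropRatio_antitone {n k s i j : ℕ} (h : k = 0 ∨ k + s ≤ n) (hij : i ≤ j) (hj : j < s) :
    dropRatio n k j ≤ dropRatio n k i := by
  rcases h with rfl | h
  · simp [dropRatio]
  · have h1 : (j : ℝ) + 1 ≤ n := by exact_mod_cast (by omega : j + 1 ≤ n)
    have h2 : (i : ℝ) ≤ j := by exact_mod_cast hij
    rw [dropRatio, dropRatio]
    have h3 : (0 : ℝ) < n - j := by linarith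
    gcongr

/-- Compare `f 0` with `g t`: if `f 0` is larger, it can replace the last factor of `∏ g`; otherwise
every `f j` is at most every `g j`. In terms of covers, one vertex in one block and `t` in another
do no better than all `t + 1` in a single block. -/
theorem min_prod_le_mul_prod (f g : ℕ → ℝ) (t : ℕ) (hf : ∀ j ≤ t, 0 ≤ f j ∧ f j ≤ f 0)
    (hg : ∀ j ≤ t, 0 ≤ g j ∧ g t ≤ g j) :
    min (∏ j ∈ Finset.range (t + 1), f j) (∏ j ∈ Finset.range (t + 1), g j) ≤
      f 0 * ∏ j ∈ Finset.range t, g j := by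
  rcases le_total (g t) (f 0) with h | h
  · refine (min_le_right _ _).trans ?_
    rw [Finset.prod_range_succ, mul_comm]
    exact mul_le_mul_of_nonneg_right h (Finset.prod_nonneg fun j hj =>
      (hg j (Finset.mem_range.1 hj).le).1)
  · refine (min_le_left _ _).trans ?_
    rw [Finset.prod_range_succ', mul_comm]
    refine mul_le_mul_of_nonneg_left (Finset.prod_le_prod (fun j hj => ?_) fun j hj => ?_)
      (hf 0 (Nat.zero_le _)).1
    · exact (hf (j + 1) (Finset.mem_range.1 hj)).1
    · exact ((hf (j + 1) (Finset.mem_range.1 hj)).2.trans h).trans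
        (hg j (Finset.mem_range.1 hj).le).2

theorem one_sub_pow_le {p : ℝ} (h0 : 0 ≤ p) (h1 : p ≤ 1) (s : ℕ) :
    (1 - p) ^ s ≤ 1 - s * p + (s * p) ^ 2 / 2 := by
  induction s with
  | zero => simp
  | succ s ih =>
    rw [pow_succ]
    have h2 := mul_le_mul_of_nonneg_right ih (sub_nonneg.2 h1)
    refine h2.trans ?_
    push_cast
    nlinarith [mul_nonneg h0 (sq_nonneg ((s : ℝ) * p)), sq_nonneg p]

end Arithmetic

/-! ### The bound as a function of the blocks -/

section Bound

variable {α : Type*} {l : ℕ} {V : Fin l → Finset α} {k : Fin l → ℕ}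

theorem cast_bound {s : ℕ} (i : Fin l) (h : k i = 0 ∨ s ≤ (V i).card) :
    (bound (fun j => (V j).card) k s i : ℝ) =
      edgeCount V k * (1 - ∏ j ∈ Finset.range s, dropRatio (V i).card (k i) j) := by
  rw [bound, edgeCount, ← Finset.mul_prod_erase _ _ (Finset.mem_univ i), Nat.cast_mul,
    Nat.cast_sub (Nat.choose_le_choose _ (Nat.sub_le _ _)), cast_choose_sub h]
  push_cast
  ring

theorem dropRatio_zero (i : Fin l) : dropRatio (V i).card (k i) 0 = 1 - density V k i := by
  simp [dropRatio, density]

theorem eq_zero_or_add_le {s : ℕ} (hs : 1 ≤ s) (j : Fin l)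
    (hn : 4 * l ^ 2 * k j ^ 2 * s ≤ (V j).card) : k j = 0 ∨ k j + s ≤ (V j).card := by
  have hl : 1 ≤ l := by have := j.2; omega
  rcases Nat.eq_zero_or_pos (k j) with h | h
  · exact Or.inl h
  right
  have h1 : k j * s ≤ l ^ 2 * k j ^ 2 * s := by
    calc k j * s = 1 ^ 2 * k j * s := by ring
      _ ≤ l ^ 2 * k j ^ 2 * s := by
        gcongr
        exact Nat.le_self_pow two_ne_zero _
  nlinarith

variable [DecidableEq α]

theorem edgeCount_update_erase {i : Fin l} {v : α} (hv : v ∈ V i) :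
    edgeCount (Function.update V i ((V i).erase v)) k = edgeCount V k * (1 - density V k i) := by
  have hpos := Finset.card_pos.2 ⟨v, hv⟩
  rw [edgeCount, edgeCount, ← Finset.mul_prod_erase _ _ (Finset.mem_univ i),
    ← Finset.mul_prod_erase (Finset.univ) (fun j => ((V j).card.choose (k j) : ℝ))
      (Finset.mem_univ i),
    Finset.prod_congr rfl (g := fun j => ((V j).card.choose (k j) : ℝ)) fun j hj => by
      rw [Function.update_of_ne (Finset.ne_of_mem_erase hj)]]
  rw [Function.update_self, Finset.card_erase_of_mem hv,
    cast_choose_sub (Or.inr hpos), Finset.prod_range_one, dropRatio_zero]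
  ring

/-- Removing a vertex costs at most what the bound loses with `s`. -/
theorem add_bound_update_le {t : ℕ} (hn : ∀ j, 4 * l ^ 2 * k j ^ 2 * (t + 1) ≤ (V j).card)
    {i : Fin l} {v : α} (hv : v ∈ V i) (i' : Fin l) :
    edgeCount V k * density V k i +
      bound (fun j => (Function.update V i ((V i).erase v) j).card) k t i' ≤
    (Finset.univ.sup (bound (fun j => (V j).card) k (t + 1)) : ℕ) := by
  have hP := edgeCount_nonneg (V := V) (k := k)
  have hok := fun j => eq_zero_or_add_le (by omega) j (hn j)
  have hb := fun j => cast_bound (V := V) (s := t + 1) j ((hok j).imp_right fun h => by omega)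
  have hsup : ∀ j, (bound (fun j => (V j).card) k (t + 1) j : ℝ) ≤
      (Finset.univ.sup (bound (fun j => (V j).card) k (t + 1)) : ℕ) := fun j =>
    Nat.cast_le.2 (Finset.le_sup (Finset.mem_univ j))
  have hcard : (Function.update V i ((V i).erase v) i).card = (V i).card - 1 := by
    rw [Function.update_self, Finset.card_erase_of_mem hv]
  have hpos := Finset.card_pos.2 ⟨v, hv⟩
  by_cases h : i' = i
  · subst h
    refine le_trans (le_of_eq ?_) (hsup i')
    rw [hb, cast_bound (V := Function.update V i' ((V i').erase v)) i' (by
      rw [hcard]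
      exact (hok i').imp_right fun h => by omega),
      edgeCount_update_erase hv, hcard, Finset.prod_range_succ', dropRatio_zero]
    -- Deleting `v` shifts the index of the ratios by one, so in the block of `v` itself the
    -- inequality is an equality.
    have : ∀ j, dropRatio ((V i').card - 1) (k i') j = dropRatio (V i').card (k i') (j + 1) := by
      intro j
      rw [dropRatio, dropRatio, Nat.cast_sub hpos]
      push_cast
      rw [sub_sub, add_comm (1 : ℝ)]
    simp only [this]
    ring
  · have hmin := min_prod_le_mul_prod (dropRatio (V i).card (k i)) (dropRatio (V i').card (k i')) t
      (fun j hj => ⟨dropRatio_nonneg (hok i) (by omega),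
        dropRatio_antitone (hok i) (Nat.zero_le _) (by omega)⟩)
      (fun j hj => ⟨dropRatio_nonneg (hok i') (by omega),
        dropRatio_antitone (hok i') hj (by omega)⟩)
    rw [dropRatio_zero] at hmin
    have heq : edgeCount V k * density V k i +
        bound (fun j => (Function.update V i ((V i).erase v) j).card) k t i' =
        edgeCount V k * (1 - (1 - density V k i) *
          ∏ j ∈ Finset.range t, dropRatio (V i').card (k i') j) := by
      rw [cast_bound (V := Function.update V i ((V i).erase v)) i' (by
        rw [Function.update_of_ne h]
        exact (hok i').imp_right fun h => by omega),
        edgeCount_update_erase hv, Function.update_of_ne h]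
      ring
    rw [heq]
    rcases min_le_iff.1 hmin with hm | hm
    · refine le_trans ?_ (hsup i)
      rw [hb]
      gcongr
    · refine le_trans ?_ (hsup i')
      rw [hb]
      gcongr

end Bound

/-! ### The induction on `s` -/

section Main

variable {α : Type*} {l : ℕ}

theorem mul_density_le_quarter {V : Fin l → Finset α} {k : Fin l → ℕ} {s : ℕ} {j : Fin l}
    (hn : 4 * l ^ 2 * k j ^ 2 * s ≤ (V j).card) : s * density V k j ≤ 1 / 4 := by
  have h := mul_density_le hn
  have hl : (1 : ℝ) ≤ l := by exact_mod_cast (by have := j.2; omega : 1 ≤ l)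
  have hd := density_nonneg (V := V) (k := k) j
  rcases Nat.eq_zero_or_pos (k j) with h0 | hpos
  · rw [density, h0]
    norm_num
  have hk : (1 : ℝ) ≤ k j := by exact_mod_cast hpos
  calc s * density V k j ≤ s * k j * density V k j := by
        refine mul_le_mul_of_nonneg_right ?_ hd
        exact le_mul_of_one_le_right (Nat.cast_nonneg _) hk
    _ ≤ 1 / (4 * (l : ℝ) ^ 2) := h
    _ ≤ 1 / 4 := by
      refine one_div_le_one_div_of_le (by norm_num) ?_
      nlinarith

variable [LinearOrder α]

/-- The bound when all degrees are small. -/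
theorem card_le_of_degree_le {V : Fin l → Finset α} {k : Fin l → ℕ} {s : ℕ} (hs : 1 ≤ s)
    (hV : ∀ i j, i ≠ j → Disjoint (V i) (V j)) (hk : ∃ i, 1 ≤ k i)
    (hn : ∀ j, 4 * l ^ 2 * k j ^ 2 * s ≤ (V j).card)
    {F : Finset (Finset α)} (hF : F ⊆ layer V k) (hsh : Shifted V F)
    (hm : ¬ HasMatching F (s + 1))
    (hdeg : ∀ i, ∀ v ∈ V i, ((F.filter (fun E => v ∈ E)).card : ℝ) ≤
      edgeCount V k * density V k i / (4 * l)) :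
    F.card ≤ Finset.univ.sup (bound (fun j => (V j).card) k s) := by
  classical
  obtain ⟨i₁, hi₁⟩ := hk
  obtain ⟨i₀, -, hi₀⟩ := Finset.exists_max_image Finset.univ (density V k) ⟨i₁, Finset.mem_univ _⟩
  replace hi₀ := fun j => hi₀ j (Finset.mem_univ j)
  set p := density V k i₀ with hp
  have hP := edgeCount_nonneg (V := V) (k := k)
  have hp0 : 0 ≤ p := density_nonneg i₀
  have hl1 : 1 ≤ l := by have := i₀.2; omega
  have hl : (1 : ℝ) ≤ l := by exact_mod_cast hl1
  have hsp : s * p ≤ 1 / 4 := mul_density_le_quarter (hn i₀)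
  have hs1 : (1 : ℝ) ≤ s := by exact_mod_cast hs
  have hn' : ∀ j, 4 * k j ^ 2 * s ≤ (V j).card := fun j => le_trans (by
    calc 4 * k j ^ 2 * s = 4 * 1 ^ 2 * k j ^ 2 * s := by ring
      _ ≤ _ := by gcongr) (hn j)
  let D : Fin l → ℝ := fun j => edgeCount V k * (density V k j * (7 / 3 * s * l * p))
  let T : Finset α := (Finset.univ.biUnion V).filter fun v =>
    ∃ i, v ∈ V i ∧ D i < (F.filter (fun E => v ∈ E)).card
  have hTs : T.card ≤ s := by
    by_contra hT
    obtain ⟨T', hT'T, hT'⟩ := Finset.exists_subset_card_eq (show s + 1 ≤ T.card by omega)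
    have hT'V : ∀ u ∈ T', ∃ i, u ∈ V i ∧ D i < (F.filter (fun E => u ∈ E)).card := fun u hu =>
      (Finset.mem_filter.1 (hT'T hu)).2
    refine hm (hT' ▸ hasMatching_of_transversal hV hF hsh fun v hv => ?_)
    obtain ⟨i, hvi, hD⟩ := hT'V v hv
    rw [hT']
    exact exists_sparse_edge hs hn' hV hF hi₀ hT' (fun u hu => (hT'V u hu).imp fun _ h => h.1)
      hv hvi hD
  -- No edge can be added to a matching of maximal size, so its vertices cover `F`.
  obtain ⟨r, hrs, ⟨f, hfF, hfd⟩, hr⟩ : ∃ r ≤ s, HasMatching F r ∧ ¬ HasMatching F (r + 1) := by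
    by_contra hcon
    push Not at hcon
    have : ∀ r ≤ s + 1, HasMatching F r := by
      intro r
      induction r with
      | zero => exact fun _ => ⟨Fin.elim0, fun a => a.elim0, fun a => a.elim0⟩
      | succ r ih => exact fun h => hcon r (by omega) (ih (by omega))
    exact hm (this _ le_rfl)
  have hcov := card_cover_le (V := V) (G := F) (U := Finset.univ.biUnion f) fun E hE => by
    by_contra hcon
    push Not at hcon
    refine hr (HasMatching.cons hfF hfd subset_rfl hE fun a => ?_)
    refine Finset.disjoint_left.2 fun u huE hua => ?_
    obtain ⟨j, hj⟩ := (mem_layer.1 (hF hE)).1 u huE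
    exact hcon j u (Finset.mem_inter.2 ⟨Finset.mem_biUnion.2 ⟨a, Finset.mem_univ a, hua⟩, hj⟩) huE
  set U := Finset.univ.biUnion f with hU
  have hdeg' : ∀ j, ∀ u ∈ U ∩ V j, ((F.filter (fun E => u ∈ E)).card : ℝ) ≤
      D j + if u ∈ T then edgeCount V k * p / (4 * l) else 0 := by
    intro j u hu
    rw [Finset.mem_inter] at hu
    have hd := density_nonneg (V := V) (k := k) j
    have hD0 : 0 ≤ D j := by positivity
    split_ifs with huT
    · refine (hdeg j u hu.2).trans ?_
      have h1 : edgeCount V k * density V k j / (4 * l) ≤ edgeCount V k * p / (4 * l) := by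
        have := hi₀ j
        gcongr
      linarith
    · by_contra hcon
      rw [not_le, add_zero] at hcon
      exact huT (Finset.mem_filter.2 ⟨Finset.mem_biUnion.2 ⟨j, Finset.mem_univ j, hu.2⟩,
        j, hu.2, hcon⟩)
  -- The constant is `7/3 * l` times the `l` block contributions `1 / (4 l²)`.
  have hA : ∑ j, ∑ _u ∈ U ∩ V j, D j ≤ 7 / 12 * (edgeCount V k * (s * p)) := by
    have h1 : ∀ j, ∑ _u ∈ U ∩ V j, D j ≤
        edgeCount V k * (7 / 3 * s * l * p) * (1 / (4 * (l : ℝ) ^ 2)) := by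
      intro j
      rw [Finset.sum_const, nsmul_eq_mul]
      have h2 := card_biUnion_inter_le (V := V) hrs (fun a => hF (hfF a)) j
      have h3 := mul_density_le (hn j)
      have hd := density_nonneg (V := V) (k := k) j
      calc _ ≤ (s * k j : ℝ) * D j := mul_le_mul_of_nonneg_right h2 (by positivity)
        _ = edgeCount V k * (7 / 3 * s * l * p) * (s * k j * density V k j) := by
          simp only [D]; ring
        _ ≤ _ := by gcongr
    refine (Finset.sum_le_sum fun j _ => h1 j).trans (le_of_eq ?_)
    rw [Finset.sum_const, Finset.card_univ, Fintype.card_fin, nsmul_eq_mul]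
    field_simp
    ring
  have hB : ∑ j, ∑ u ∈ U ∩ V j, (if u ∈ T then edgeCount V k * p / (4 * l) else 0) ≤
      1 / 4 * (edgeCount V k * (s * p)) := by
    have h1 : ∑ j, ((U ∩ V j).filter (· ∈ T)).card ≤ s := by
      rw [← Finset.card_biUnion]
      · refine (Finset.card_le_card fun u hu => ?_).trans hTs
        obtain ⟨j, -, hj⟩ := Finset.mem_biUnion.1 hu
        exact (Finset.mem_filter.1 hj).2
      · intro i _ j _ hij
        exact (hV i j hij).mono ((Finset.filter_subset _ _).trans Finset.inter_subset_right)
          ((Finset.filter_subset _ _).trans Finset.inter_subset_right)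
    have h2 : ∑ j, (((U ∩ V j).filter (· ∈ T)).card : ℝ) ≤ s := by exact_mod_cast h1
    have h3 : ∀ j, ∑ u ∈ U ∩ V j, (if u ∈ T then edgeCount V k * p / (4 * l) else 0) =
        (((U ∩ V j).filter (· ∈ T)).card : ℝ) * (edgeCount V k * p / (4 * l)) := by
      intro j
      rw [← Finset.sum_filter, Finset.sum_const, nsmul_eq_mul]
    rw [Finset.sum_congr rfl fun j _ => h3 j, ← Finset.sum_mul]
    calc _ ≤ (s : ℝ) * (edgeCount V k * p / (4 * l)) :=
          mul_le_mul_of_nonneg_right h2 (by positivity)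
      _ ≤ s * (edgeCount V k * p / (4 * 1)) := by gcongr
      _ = _ := by ring
  have hFle : (F.card : ℝ) ≤ 5 / 6 * (edgeCount V k * (s * p)) := by
    refine hcov.trans ((Finset.sum_le_sum fun j _ => Finset.sum_le_sum (hdeg' j)).trans ?_)
    simp only [Finset.sum_add_distrib]
    linarith
  have hok := eq_zero_or_add_le hs i₀ (hn i₀)
  have hb := cast_bound (V := V) (s := s) i₀ (hok.imp_right fun h => by omega)
  have hprod : ∏ j ∈ Finset.range s, dropRatio (V i₀).card (k i₀) j ≤ (1 - p) ^ s := by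
    rw [hp, ← dropRatio_zero, ← Finset.card_range s, ← Finset.prod_const, Finset.card_range]
    exact Finset.prod_le_prod (fun j hj => dropRatio_nonneg hok (Finset.mem_range.1 hj))
      fun j hj => dropRatio_antitone hok (Nat.zero_le _) (Finset.mem_range.1 hj)
  have hp1 : p ≤ 1 := by nlinarith
  have hpow := one_sub_pow_le hp0 hp1 s
  -- With `s * p ≤ 1/4`, `1 - (1 - p)^s ≥ s p (1 - s p / 2) ≥ 7/8 * s p`.
  have hfinal : 7 / 8 * (edgeCount V k * (s * p)) ≤
      (bound (fun j => (V j).card) k s i₀ : ℝ) := by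
    rw [hb]
    have hsp0 : 0 ≤ s * p := by positivity
    have h1 : 7 / 8 * (s * p) ≤
        1 - ∏ j ∈ Finset.range s, dropRatio (V i₀).card (k i₀) j := by nlinarith
    nlinarith [mul_le_mul_of_nonneg_left h1 hP]
  have hle : F.card ≤ bound (fun j => (V j).card) k s i₀ := by
    have : (0 : ℝ) ≤ edgeCount V k * (s * p) := by positivity
    exact_mod_cast (by linarith : (F.card : ℝ) ≤ (bound (fun j => (V j).card) k s i₀ : ℝ))
  exact hle.trans (Finset.le_sup (Finset.mem_univ i₀))

theorem card_le_sup_bound (s : ℕ) : ∀ (V : Fin l → Finset α) (k : Fin l → ℕ)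
    (F : Finset (Finset α)), (∀ i j, i ≠ j → Disjoint (V i) (V j)) → (∃ i, 1 ≤ k i) →
    (∀ j, 4 * l ^ 2 * k j ^ 2 * s ≤ (V j).card) → F ⊆ layer V k → ¬ HasMatching F (s + 1) →
    F.card ≤ Finset.univ.sup (bound (fun j => (V j).card) k s) := by
  induction s with
  | zero =>
    intro V k F _ _ _ _ hm
    rcases F.eq_empty_or_nonempty with h | ⟨E, hE⟩
    · simp [h]
    · exact absurd ⟨fun _ => E, fun _ => hE, fun a b h => absurd (Fin.ext (by omega)) h⟩ hm
  | succ t ih =>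
    intro V k F₀ hV hk hn hF₀ hm₀
    obtain ⟨F, hF, hcard, hm, hsh⟩ := exists_shifted hV hF₀ hm₀
    rw [← hcard]
    by_cases hdeg : ∀ i, ∀ v ∈ V i, ((F.filter (fun E => v ∈ E)).card : ℝ) ≤
      edgeCount V k * density V k i / (4 * l)
    · exact card_le_of_degree_le (by omega) hV hk hn hF hsh hm hdeg
    push Not at hdeg
    obtain ⟨i, v, hv, hdeg⟩ := hdeg
    let V' := Function.update V i ((V i).erase v)
    have hV'V : ∀ j, V' j ⊆ V j := by
      intro j
      by_cases h : j = i
      · subst h; simpa [V'] using Finset.erase_subset v (V j)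
      · simp [V', h]
    have hF' : F.filter (fun E => v ∉ E) ⊆ layer V' k := by
      intro E hE
      rw [Finset.mem_filter] at hE
      have hE' := mem_layer.1 (hF hE.1)
      have hint : ∀ j, E ∩ V' j = E ∩ V j := by
        intro j
        by_cases h : j = i
        · subst h
          simp only [V', Function.update_self]
          rw [Finset.inter_erase, Finset.erase_eq_of_notMem (by simp [hE.2])]
        · simp [V', h]
      rw [mem_layer]
      refine ⟨fun x hx => ?_, fun j => by rw [hint, hE'.2 j]⟩
      obtain ⟨j, hj⟩ := hE'.1 x hx
      exact ⟨j, (Finset.mem_inter.1 ((hint j).symm ▸ Finset.mem_inter.2 ⟨hx, hj⟩)).2⟩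
    have hm' : ¬ HasMatching (F.filter (fun E => v ∉ E)) (t + 1) := by
      rintro ⟨f, hf, hd⟩
      obtain ⟨E, hE, hEf⟩ := exists_disjoint_edge (by omega) hn hF hv hdeg hf
      exact hm (HasMatching.cons hf hd (Finset.filter_subset _ _) hE hEf)
    have hki : 1 ≤ k i := by
      by_contra h
      have h0 : k i = 0 := by omega
      have h1 := card_filter_mem_le (k := k) hv
      have h2 : ((F.filter (fun E => v ∈ E)).card : ℝ) ≤
          ((layer V k).filter (fun E => v ∈ E)).card := by
        exact_mod_cast Finset.card_le_card (Finset.filter_subset_filter _ hF)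
      have h3 : density V k i = 0 := by simp [density, h0]
      rw [h3] at h1 hdeg
      simp only [mul_zero, zero_div] at h1 hdeg
      linarith
    have hn' : ∀ j, 4 * l ^ 2 * k j ^ 2 * t ≤ (V' j).card := by
      intro j
      have hj := hn j
      rw [mul_add, mul_one] at hj
      by_cases h : j = i
      · subst h
        have hl : 1 ≤ l := by have := j.2; omega
        -- Lowering `s` by one relaxes the size condition by this amount, which pays for the deleted
        -- vertex.
        have h1 : 1 ≤ 4 * l ^ 2 * k j ^ 2 := Nat.succ_le_of_lt (by positivity)
        simp only [V', Function.update_self]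
        rw [Finset.card_erase_of_mem hv]
        omega
      · simp only [V', Function.update_of_ne h]
        omega
    have hrec := ih V' k _ (fun a b hab => (hV a b hab).mono (hV'V a) (hV'V b)) hk hn' hF' hm'
    obtain ⟨i', -, hi'⟩ := Finset.exists_mem_eq_sup Finset.univ ⟨i, Finset.mem_univ i⟩
      (bound (fun j => (V' j).card) k t)
    rw [hi'] at hrec
    have hadd := add_bound_update_le hn hv i'
    have h1 := card_filter_mem_le (k := k) hv
    have h2 : ((F.filter (fun E => v ∈ E)).card : ℝ) ≤
        ((layer V k).filter (fun E => v ∈ E)).card := by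
      exact_mod_cast Finset.card_le_card (Finset.filter_subset_filter _ hF)
    have h3 := Finset.card_filter_add_card_filter_not (s := F) (fun E => v ∈ E)
    have h4 : (F.card : ℝ) = (F.filter (fun E => v ∈ E)).card +
        (F.filter (fun E => v ∉ E)).card := by exact_mod_cast h3.symm
    have h5 : ((F.filter (fun E => v ∉ E)).card : ℝ) ≤
        bound (fun j => (V' j).card) k t i' := by exact_mod_cast hrec
    refine Nat.cast_le (α := ℝ).1 ?_
    rw [h4]
    linarith

end Main

end DirectProduct

/-! ### The theorem -/

theorem theorem1p2 {α : Type*} [DecidableEq α] (l s : ℕ) (n k : Fin l → ℕ)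
    (V : Fin l → Finset α)
    (hV : ∀ i j, i ≠ j → Disjoint (V i) (V j))
    (hcard : ∀ i, (V i).card = n i)
    (hk : ∃ i, 1 ≤ k i)
    (hn : ∀ i, 4 * l ^ 2 * (k i) ^ 2 * s ≤ n i) :
    -- the upper bound
    (∀ F : Finset (Finset α), F ⊆ DirectProduct.layer V k →
      DirectProduct.matchingNumber F ≤ s →
        F.card ≤ Finset.univ.sup (DirectProduct.bound n k s)) ∧
    -- every family of all sets meeting a fixed `s`-subset of `V i` is admissible, with its size
    (∀ (i : Fin l) (S : Finset α), S ⊆ V i → S.card = s →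
      DirectProduct.matchingNumber (DirectProduct.meeting V k S) ≤ s ∧
        (DirectProduct.meeting V k S).card = DirectProduct.bound n k s i) ∧
    -- one of these families attains the upper bound
    (∃ (i : Fin l) (S : Finset α), S ⊆ V i ∧ S.card = s ∧
      (DirectProduct.meeting V k S).card =
        Finset.univ.sup (DirectProduct.bound n k s)) := by
  obtain rfl : (fun i => (V i).card) = n := funext hcard
  have hsize : ∀ (i : Fin l) (S : Finset α), S ⊆ V i → S.card = s →
      (DirectProduct.meeting V k S).card = DirectProduct.bound (fun i => (V i).card) k s i := by
    rintro i S hS rfl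
    exact DirectProduct.card_meeting hV i hS
  refine ⟨fun F hF hs => ?_, fun i S hS hSs =>
    ⟨hSs ▸ DirectProduct.matchingNumber_meeting_le S, hsize i S hS hSs⟩, ?_⟩
  -- Shifting needs some linear order on the vertices; any one will do.
  · let o : LinearOrder α := by
      classical exact linearOrderOfSTO WellOrderingRel
    obtain rfl : ‹DecidableEq α› = o.toDecidableEq := Subsingleton.elim _ _
    refine DirectProduct.card_le_sup_bound s V k F hV hk hn hF fun hm => ?_
    -- Some `k i ≥ 1` excludes the empty set from the layer, so an indexed matching has distinct
    -- members.
    have := hm.le_matchingNumber fun h0 => by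
      obtain ⟨i, hi⟩ := hk
      have := (DirectProduct.mem_layer.1 (hF h0)).2 i
      simp at this
      omega
    omega
  · have large : ∀ i, 1 ≤ k i → s ≤ (V i).card := fun i hi => by
      rcases Nat.eq_zero_or_pos s with h | h
      · omega
      · rcases DirectProduct.eq_zero_or_add_le h i (hn i) with h' | h' <;> omega
    obtain ⟨i, hi, hsup⟩ : ∃ i, 1 ≤ k i ∧ Finset.univ.sup
        (DirectProduct.bound (fun i => (V i).card) k s) =
          DirectProduct.bound (fun i => (V i).card) k s i := by
      obtain ⟨i₁, hi₁⟩ := hk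
      obtain ⟨i, -, hi⟩ := Finset.exists_mem_eq_sup Finset.univ ⟨i₁, Finset.mem_univ i₁⟩
        (DirectProduct.bound (fun i => (V i).card) k s)
      -- If the maximum is attained at `k i = 0`, it is `0`, and `V i` may have fewer than `s`
      -- elements. A block with `k i₁ ≥ 1` then attains it too and is large enough.
      rcases Nat.eq_zero_or_pos (k i) with h | h
      · refine ⟨i₁, hi₁, le_antisymm ?_ (Finset.le_sup (Finset.mem_univ i₁))⟩
        rw [hi]
        simp [DirectProduct.bound, h]
      · exact ⟨i, h, hi⟩
    obtain ⟨S, hS, hSs⟩ := Finset.exists_subset_card_eq (large i hi)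
    exact ⟨i, S, hS, hSs, hsup ▸ hsize i S hS hSs⟩
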